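/- A *prop* is a strict symmetric monoidal category whose objects are the natural numbers and whose monoidal product is addition on objects; its symmetries are written $\mathsf{swap}_{m,n} \colon m+n \to n+m$. A *controllable prop* (*crop*) $(\mathbf P, +, 0, x)$ is a prop all of whose morphisms are endomorphisms, together with a distinguished involution $x \colon 1 \to 1$. A *crop morphism* is an identity-on-objects strict symmetric monoidal functor that preserves the distinguished involution, and a crop isomorphism is a crop morphism that has an inverse crop morphism. The *controlled prop* $\mathbf{cP}$ of a crop $\mathbf P$ is the prop obtained from $\mathbf P$ by freely adjoining operations $C^0, C^1$ that send each $f \colon n \to n$ to $C^b(f) \colon 1+n \to 1+n$, subject to the following equations for all $m, n$ and all $f, g, f_1, f_2 \colon n \to n$: 1. $C^1(g \circ f) = C^1(g) \circ C^1(f)$; 2. $C^1(\mathrm{id}_n) = \mathrm{id}_{1+n}$; 3. $C^1(f + \mathrm{id}_m) = C^1(f) + \mathrm{id}_m$; 4. $(x + \mathrm{id}_n) \circ C^0(f) \circ (x + \mathrm{id}_n) = C^1(f)$; 5. $C^0(f) \circ C^1(f) = \mathrm{id}_1 + f$; 6. $C^0(f_1) \circ C^1(f_2) = C^1(f_2)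 \circ C^0(f_1)$; 7. $C^1(x) \circ \mathsf{swap}_{1,1} \circ C^1(x) \circ \mathsf{swap}_{1,1} \circ C^1(x) = \mathsf{swap}_{1,1}$; 8. $(\mathsf{swap}_{1,1} + \mathrm{id}_n) \circ C^1(C^1(f)) = C^1(C^1(f)) \circ (\mathsf{swap}_{1,1} + \mathrm{id}_n)$. It is again a crop, with the involution $x$ of $\mathbf P$. Let $\mathbf X$ be the crop generated as a prop by a single morphism $x \colon 1 \to 1$ subject to $x \circ x = \mathrm{id}_1$. Let $\mathbf{Perm}_2$ be the following crop. Its morphisms $n \to n$ are the permutations of $[2^n] = \{0, \dots, 2^n - 1\}$, and there are no morphisms $m \to n$ for $m \neq n$. The monoidal product of $f \colon m \to m$ and $g \colon n \to n$ is $f \otimes g \colon a 2^n + b \mapsto f(a) 2^n + g(b)$ for $a \in [2^m]$, $b \in [2^n]$. The symmetry $m+n \to n+m$ is $a 2^n + b \mapsto b 2^m + a$. The distinguished involution is the transposition $\gamma_{1,1}$ of $[2]$. **Theorem.** The controlled prop $\mathbf{cX}$ is crop isomorphic to $\mathbf{Perm}_2$. -/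

import Mathlib

universe u

/-- Transport of a morphism along equalities of its source and its target. -/
def recast {F : ℕ → ℕ → Type u} {m n m' n' : ℕ} (f : F m n) (hm : m = m') (hn : n = n') :
    F m' n' :=
  hm ▸ hn ▸ f

/-- A prop: a strict symmetric monoidal category whose objects are the natural numbers and whose
monoidal product is addition on objects. Composition is written in diagrammatic order:
`comp f g` is `g ∘ f`. Strictness means that the associators and unitors are the identities of
`(l + m) + n = l + (m + n)` and so on, which are made explicit by `recast`. -/
structure PROP where
  Hom : ℕ → ℕ → Type u
  id (n : ℕ) : Hom n n
  comp {l m n : ℕ} (f : Hom l m) (g : Hom m n) : Hom l n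
  tensor {m n m' n' : ℕ} (f : Hom m n) (g : Hom m' n') : Hom (m + m') (n + n')
  swap (m n : ℕ) : Hom (m + n) (n + m)
  id_comp {m n : ℕ} (f : Hom m n) : comp (id m) f = f
  comp_id {m n : ℕ} (f : Hom m n) : comp f (id n) = f
  comp_assoc {k l m n : ℕ} (f : Hom k l) (g : Hom l m) (h : Hom m n) :
    comp (comp f g) h = comp f (comp g h)
  tensor_id (m n : ℕ) : tensor (id m) (id n) = id (m + n)
  tensor_comp {l m n l' m' n' : ℕ} (f : Hom l m) (g : Hom m n) (f' : Hom l' m')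
    (g' : Hom m' n') : tensor (comp f g) (comp f' g') = comp (tensor f f') (tensor g g')
  tensor_assoc {m n m' n' m'' n'' : ℕ} (f : Hom m n) (g : Hom m' n') (h : Hom m'' n'') :
    recast (tensor (tensor f g) h) (Nat.add_assoc m m' m'') (Nat.add_assoc n n' n'') =
      tensor f (tensor g h)
  tensor_unit_left {m n : ℕ} (f : Hom m n) :
    recast (tensor (id 0) f) (Nat.zero_add m) (Nat.zero_add n) = f
  tensor_unit_right {m n : ℕ} (f : Hom m n) :
    recast (tensor f (id 0)) (Nat.add_zero m) (Nat.add_zero n) = f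
  swap_natural {m n m' n' : ℕ} (f : Hom m n) (g : Hom m' n') :
    comp (tensor f g) (swap n n') = comp (swap m m') (tensor g f)
  swap_swap (m n : ℕ) : comp (swap m n) (swap n m) = id (m + n)
  swap_hexagon (l m n : ℕ) :
    recast (swap l (m + n)) (Nat.add_assoc l m n).symm (Nat.add_assoc m n l) =
      comp (recast (tensor (swap l m) (id n)) rfl (Nat.add_assoc m l n))
        (tensor (id m) (swap l n))

/-- A controllable prop (crop): a prop all of whose morphisms are endomorphisms, together with
a distinguished involution `x : 1 ⟶ 1`. -/
structure Crop extends PROP.{u} where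
  endo {m n : ℕ} (f : Hom m n) : m = n
  x : Hom 1 1
  x_comp_x : comp x x = id 1

/-- A crop morphism: an identity-on-objects strict symmetric monoidal functor that preserves the
distinguished involution. -/
structure CropHom (P Q : Crop.{u}) where
  map {m n : ℕ} (f : P.Hom m n) : Q.Hom m n
  map_id (n : ℕ) : map (P.id n) = Q.id n
  map_comp {l m n : ℕ} (f : P.Hom l m) (g : P.Hom m n) :
    map (P.comp f g) = Q.comp (map f) (map g)
  map_tensor {m n m' n' : ℕ} (f : P.Hom m n) (g : P.Hom m' n') :
    map (P.tensor f g) = Q.tensor (map f) (map g)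
  map_swap (m n : ℕ) : map (P.swap m n) = Q.swap m n
  map_x : map P.x = Q.x

/-- An isomorphism of crops: two mutually inverse crop morphisms. -/
structure CropIso (P Q : Crop.{u}) where
  hom : CropHom P Q
  inv : CropHom Q P
  hom_inv {m n : ℕ} (f : P.Hom m n) : inv.map (hom.map f) = f
  inv_hom {m n : ℕ} (g : Q.Hom m n) : hom.map (inv.map g) = g

/-! ### Props presented by generators and relations -/

/-- Formal expressions built from generating morphisms `G`, identities, composition, monoidal
product, symmetries, and, for every `b : K`, an operation `ctrl b` that takes `f : n ⟶ n` to
`ctrl b f : 1 + n ⟶ 1 + n`. For `K = Empty` these are the expressions of the ordinary free prop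
on `G`. -/
inductive Expr (G : ℕ → ℕ → Type u) (K : Type) : ℕ → ℕ → Type u
  | gen {m n : ℕ} (g : G m n) : Expr G K m n
  | id (n : ℕ) : Expr G K n n
  | comp {l m n : ℕ} (f : Expr G K l m) (g : Expr G K m n) : Expr G K l n
  | tensor {m n m' n' : ℕ} (f : Expr G K m n) (g : Expr G K m' n') :
      Expr G K (m + m') (n + n')
  | swap (m n : ℕ) : Expr G K (m + n) (n + m)
  | ctrl (b : K) {n : ℕ} (f : Expr G K n n) : Expr G K (1 + n) (1 + n)

/-- If all generators are endomorphisms, so are all expressions. -/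
theorem Expr.endo {G : ℕ → ℕ → Type u} {K : Type} (hG : ∀ m n : ℕ, G m n → m = n) {m n : ℕ}
    (f : Expr G K m n) : m = n := by
  induction f with
  | gen g => exact hG _ _ g
  | id n => rfl
  | comp f g hf hg => exact hf.trans hg
  | tensor f g hf hg => rw [hf, hg]
  | swap m n => exact Nat.add_comm m n
  | ctrl b f hf => rfl

open Expr in
/-- The smallest congruence (for all the operations) on expressions that contains the relations
`R` and the laws of a prop. -/
inductive Conv {G : ℕ → ℕ → Type u} {K : Type}
    (R : ∀ m n : ℕ, Expr G K m n → Expr G K m n → Prop) :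
    ∀ m n : ℕ, Expr G K m n → Expr G K m n → Prop
  | rel {m n : ℕ} {f g : Expr G K m n} (h : R m n f g) : Conv R _ _ f g
  | refl {m n : ℕ} (f : Expr G K m n) : Conv R _ _ f f
  | symm {m n : ℕ} {f g : Expr G K m n} (h : Conv R _ _ f g) : Conv R _ _ g f
  | trans {m n : ℕ} {f g h : Expr G K m n} (h₁ : Conv R _ _ f g) (h₂ : Conv R _ _ g h) :
      Conv R _ _ f h
  | comp_congr {l m n : ℕ} {f f' : Expr G K l m} {g g' : Expr G K m n} (h₁ : Conv R _ _ f f')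
      (h₂ : Conv R _ _ g g') : Conv R _ _ (comp f g) (comp f' g')
  | tensor_congr {m n m' n' : ℕ} {f f' : Expr G K m n} {g g' : Expr G K m' n'}
      (h₁ : Conv R _ _ f f') (h₂ : Conv R _ _ g g') : Conv R _ _ (tensor f g) (tensor f' g')
  | ctrl_congr (b : K) {n : ℕ} {f f' : Expr G K n n} (h : Conv R _ _ f f') :
      Conv R _ _ (ctrl b f) (ctrl b f')
  | id_comp {m n : ℕ} (f : Expr G K m n) : Conv R _ _ (comp (Expr.id m) f) f
  | comp_id {m n : ℕ} (f : Expr G K m n) : Conv R _ _ (comp f (Expr.id n)) f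
  | comp_assoc {k l m n : ℕ} (f : Expr G K k l) (g : Expr G K l m) (h : Expr G K m n) :
      Conv R _ _ (comp (comp f g) h) (comp f (comp g h))
  | tensor_id (m n : ℕ) : Conv R _ _ (tensor (Expr.id m) (Expr.id n)) (Expr.id (m + n))
  | tensor_comp {l m n l' m' n' : ℕ} (f : Expr G K l m) (g : Expr G K m n)
      (f' : Expr G K l' m') (g' : Expr G K m' n') :
      Conv R _ _ (tensor (comp f g) (comp f' g')) (comp (tensor f f') (tensor g g'))
  | tensor_assoc {m n m' n' m'' n'' : ℕ} (f : Expr G K m n) (g : Expr G K m' n')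
      (h : Expr G K m'' n'') :
      Conv R _ _
        (recast (tensor (tensor f g) h) (Nat.add_assoc m m' m'') (Nat.add_assoc n n' n''))
        (tensor f (tensor g h))
  | tensor_unit_left {m n : ℕ} (f : Expr G K m n) :
      Conv R _ _ (recast (tensor (Expr.id 0) f) (Nat.zero_add m) (Nat.zero_add n)) f
  | tensor_unit_right {m n : ℕ} (f : Expr G K m n) :
      Conv R _ _ (recast (tensor f (Expr.id 0)) (Nat.add_zero m) (Nat.add_zero n)) f
  | swap_natural {m n m' n' : ℕ} (f : Expr G K m n) (g : Expr G K m' n') :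
      Conv R _ _ (comp (tensor f g) (swap n n')) (comp (swap m m') (tensor g f))
  | swap_swap (m n : ℕ) : Conv R _ _ (comp (swap m n) (swap n m)) (Expr.id (m + n))
  | swap_hexagon (l m n : ℕ) :
      Conv R _ _ (recast (swap l (m + n)) (Nat.add_assoc l m n).symm (Nat.add_assoc m n l))
        (comp (recast (tensor (swap l m) (Expr.id n)) rfl (Nat.add_assoc m l n))
          (tensor (Expr.id m) (swap l n)))

section Presented

variable {G : ℕ → ℕ → Type u} {K : Type} (R : ∀ m n : ℕ, Expr G K m n → Expr G K m n → Prop)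

theorem recast_quot_mk {m n m' n' : ℕ} (f : Expr G K m n) (hm : m = m') (hn : n = n') :
    recast (F := fun m n => Quot (Conv R m n)) (Quot.mk _ f) hm hn =
      Quot.mk _ (recast f hm hn) := by
  subst hm; subst hn; rfl

/-- The prop presented by the generators `G` (closed under the operations `ctrl b`) and the
relations `R`. -/
def presentedProp : PROP.{u} where
  Hom m n := Quot (Conv R m n)
  id n := Quot.mk _ (Expr.id n)
  comp := Quot.map₂ Expr.comp (fun _ _ _ h => .comp_congr (.refl _) h)
    (fun _ _ _ h => .comp_congr h (.refl _))
  tensor := Quot.map₂ Expr.tensor (fun _ _ _ h => .tensor_congr (.refl _) h)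
    (fun _ _ _ h => .tensor_congr h (.refl _))
  swap m n := Quot.mk _ (Expr.swap m n)
  id_comp := by rintro m n ⟨f⟩; exact Quot.sound (.id_comp f)
  comp_id := by rintro m n ⟨f⟩; exact Quot.sound (.comp_id f)
  comp_assoc := by rintro k l m n ⟨f⟩ ⟨g⟩ ⟨h⟩; exact Quot.sound (.comp_assoc f g h)
  tensor_id m n := Quot.sound (.tensor_id m n)
  tensor_comp := by
    rintro l m n l' m' n' ⟨f⟩ ⟨g⟩ ⟨f'⟩ ⟨g'⟩; exact Quot.sound (.tensor_comp f g f' g')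
  tensor_assoc := by
    rintro m n m' n' m'' n'' ⟨f⟩ ⟨g⟩ ⟨h⟩
    exact (recast_quot_mk R _ _ _).trans (Quot.sound (.tensor_assoc f g h))
  tensor_unit_left := by
    rintro m n ⟨f⟩
    exact (recast_quot_mk R _ _ _).trans (Quot.sound (.tensor_unit_left f))
  tensor_unit_right := by
    rintro m n ⟨f⟩
    exact (recast_quot_mk R _ _ _).trans (Quot.sound (.tensor_unit_right f))
  swap_natural := by rintro m n m' n' ⟨f⟩ ⟨g⟩; exact Quot.sound (.swap_natural f g)
  swap_swap m n := Quot.sound (.swap_swap m n)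
  swap_hexagon l m n := by
    refine (recast_quot_mk R _ _ _).trans ((Quot.sound (.swap_hexagon l m n)).trans ?_)
    have h := recast_quot_mk R (Expr.tensor (Expr.swap l m) (Expr.id n)) rfl
      (Nat.add_assoc m l n)
    exact congrArg (fun t => Quot.map₂ Expr.comp (fun _ _ _ h => .comp_congr (.refl _) h)
      (fun _ _ _ h => .comp_congr h (.refl _)) t
      (Quot.mk _ (Expr.tensor (Expr.id m) (Expr.swap l n)))) h.symm

end Presented

/-! ### The crop generated by a single involution -/

/-- A single generator `x : 1 ⟶ 1`. -/
inductive NotGen : ℕ → ℕ → Type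
  | x : NotGen 1 1

/-- The single relation `x ∘ x = id`. -/
inductive NotRel : ∀ m n : ℕ, Expr NotGen Empty m n → Expr NotGen Empty m n → Prop
  | invol : NotRel _ _ (.comp (.gen .x) (.gen .x)) (.id 1)

/-- The crop `X` generated by the NOT gate `x` alone. -/
def cropX : Crop.{0} where
  toPROP := presentedProp NotRel
  endo := by
    rintro m n ⟨f⟩
    exact f.endo (fun _ _ g => by cases g; rfl)
  x := Quot.mk _ (.gen .x)
  x_comp_x := Quot.sound (.rel .invol)

/-! ### Controlled props -/

open Expr in
/-- The relations of the controlled prop of `P`. The first four say that the given crop maps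
into it by a prop morphism; the others are the control equations, where `ctrl true` is `C¹` and
`ctrl false` is `C⁰`. -/
inductive ControlRel (P : Crop.{u}) :
    ∀ m n : ℕ, Expr P.Hom Bool m n → Expr P.Hom Bool m n → Prop
  | gen_id (n : ℕ) : ControlRel P _ _ (gen (P.id n)) (Expr.id n)
  | gen_comp {l m n : ℕ} (f : P.Hom l m) (g : P.Hom m n) :
      ControlRel P _ _ (gen (P.comp f g)) (comp (gen f) (gen g))
  | gen_tensor {m n m' n' : ℕ} (f : P.Hom m n) (g : P.Hom m' n') :
      ControlRel P _ _ (gen (P.tensor f g)) (tensor (gen f) (gen g))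
  | gen_swap (m n : ℕ) : ControlRel P _ _ (gen (P.swap m n)) (swap m n)
  | composition {n : ℕ} (f g : Expr P.Hom Bool n n) :
      ControlRel P _ _ (ctrl true (comp f g)) (comp (ctrl true f) (ctrl true g))
  | identity (n : ℕ) : ControlRel P _ _ (ctrl true (Expr.id n)) (Expr.id (1 + n))
  | strength {n : ℕ} (f : Expr P.Hom Bool n n) (m : ℕ) :
      ControlRel P _ _
        (recast (ctrl true (tensor f (Expr.id m))) (Nat.add_assoc 1 n m).symm
          (Nat.add_assoc 1 n m).symm)
        (tensor (ctrl true f) (Expr.id m))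
  | colour {n : ℕ} (f : Expr P.Hom Bool n n) :
      ControlRel P _ _
        (comp (comp (tensor (gen P.x) (Expr.id n)) (ctrl false f)) (tensor (gen P.x) (Expr.id n)))
        (ctrl true f)
  | complementarity {n : ℕ} (f : Expr P.Hom Bool n n) :
      ControlRel P _ _ (comp (ctrl true f) (ctrl false f)) (tensor (Expr.id 1) f)
  | commutativity {n : ℕ} (f₁ f₂ : Expr P.Hom Bool n n) :
      ControlRel P _ _ (comp (ctrl true f₂) (ctrl false f₁)) (comp (ctrl false f₁) (ctrl true f₂))
  | swap_rule :
      ControlRel P _ _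
        (comp (comp (comp (comp (ctrl true (gen P.x)) (swap 1 1)) (ctrl true (gen P.x)))
          (swap 1 1)) (ctrl true (gen P.x)))
        (swap 1 1)
  | swap_coherence {n : ℕ} (f : Expr P.Hom Bool n n) :
      ControlRel P _ _
        (comp (ctrl true (ctrl true f))
          (recast (tensor (swap 1 1) (Expr.id n)) (Nat.add_assoc 1 1 n) (Nat.add_assoc 1 1 n)))
        (comp
          (recast (tensor (swap 1 1) (Expr.id n)) (Nat.add_assoc 1 1 n) (Nat.add_assoc 1 1 n))
          (ctrl true (ctrl true f)))

/-- The controlled prop `cP` of a crop `P`, which is again a crop with the NOT gate of `P`. -/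
def controlled (P : Crop.{u}) : Crop.{u} where
  toPROP := presentedProp (ControlRel P)
  endo := by
    rintro m n ⟨f⟩
    exact f.endo (fun _ _ g => P.endo g)
  x := Quot.mk _ (.gen P.x)
  x_comp_x := by
    refine Quot.sound (.trans (.symm (.rel (.gen_comp P.x P.x))) ?_)
    rw [P.x_comp_x]
    exact .rel (.gen_id 1)

/-! ### Permutations -/

/-- Morphisms of the category `Perm` of permutations: there are none between different numbers,
and the morphisms `n ⟶ n` are the permutations of `[n]`. -/
abbrev PermHom (m n : ℕ) : Type := Fin m ≃ Fin n

/-- The tensor product of permutations, `a n + b ↦ f(a) n + g(b)`. -/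
def permTensor {m n m' n' : ℕ} (f : PermHom m n) (g : PermHom m' n') :
    PermHom (m * m') (n * n') :=
  (finProdFinEquiv.symm.trans (f.prodCongr g)).trans finProdFinEquiv

/-- The symmetry of the tensor product, `a n + b ↦ b m + a`. -/
def permTensorSymm (m n : ℕ) : PermHom (m * n) (n * m) :=
  (finProdFinEquiv.symm.trans (Equiv.prodComm (Fin m) (Fin n))).trans finProdFinEquiv

/-- The symmetry of the direct sum, `i ↦ n + i` for `i < m` and `i ↦ i - m` otherwise. -/
def permSumSymm (m n : ℕ) : PermHom (m + n) (n + m) := finAddFlip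

/-- The tensor product on the full subcategory of `Perm` on the powers of two. -/
def perm2Tensor {m n m' n' : ℕ} (f : PermHom (2 ^ m) (2 ^ n)) (g : PermHom (2 ^ m') (2 ^ n')) :
    PermHom (2 ^ (m + m')) (2 ^ (n + n')) :=
  recast (permTensor f g) (Nat.pow_add 2 m m').symm (Nat.pow_add 2 n n').symm

/-- The symmetry `2 ^ m ⊗ 2 ^ n ⟶ 2 ^ n ⊗ 2 ^ m`. -/
def perm2Swap (m n : ℕ) : PermHom (2 ^ (m + n)) (2 ^ (n + m)) :=
  recast (permTensorSymm (2 ^ m) (2 ^ n)) (Nat.pow_add 2 m n).symm (Nat.pow_add 2 n m).symm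

/-- The element `a 2 ^ n + b` of `[2 ^ (m + n)]`. -/
def perm2Pair {m n : ℕ} (a : Fin (2 ^ m)) (b : Fin (2 ^ n)) : Fin (2 ^ (m + n)) :=
  Fin.cast (Nat.pow_add 2 m n).symm (finProdFinEquiv (a, b))

theorem perm2Pair_val {m n : ℕ} (a : Fin (2 ^ m)) (b : Fin (2 ^ n)) :
    (perm2Pair a b : ℕ) = b + 2 ^ n * a := rfl

theorem perm2Pair_surj {m n : ℕ} (i : Fin (2 ^ (m + n))) :
    ∃ (a : Fin (2 ^ m)) (b : Fin (2 ^ n)), i = perm2Pair a b := by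
  refine ⟨(finProdFinEquiv.symm (Fin.cast (Nat.pow_add 2 m n) i)).1,
    (finProdFinEquiv.symm (Fin.cast (Nat.pow_add 2 m n) i)).2, ?_⟩
  rw [perm2Pair, Prod.mk.eta, Equiv.apply_symm_apply]
  rfl

theorem recast_permHom_apply {m n m' n' : ℕ} (f : PermHom m n) (hm : m = m') (hn : n = n')
    (i : Fin m') : (recast (F := PermHom) f hm hn) i = Fin.cast hn (f (Fin.cast hm.symm i)) := by
  subst hm; subst hn; rfl

theorem recast_permHom_pow_apply {m n m' n' : ℕ} (f : PermHom (2 ^ m) (2 ^ n)) (hm : m = m')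
    (hn : n = n') (i : Fin (2 ^ m')) :
    (recast (F := fun m n => PermHom (2 ^ m) (2 ^ n)) f hm hn : PermHom (2 ^ m') (2 ^ n')) i =
      Fin.cast (congrArg (2 ^ ·) hn) (f (Fin.cast (congrArg (2 ^ ·) hm.symm) i)) := by
  subst hm; subst hn; rfl

theorem perm2Tensor_pair {m n m' n' : ℕ} (f : PermHom (2 ^ m) (2 ^ n))
    (g : PermHom (2 ^ m') (2 ^ n')) (a : Fin (2 ^ m)) (b : Fin (2 ^ m')) :
    perm2Tensor f g (perm2Pair a b) = perm2Pair (f a) (g b) := by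
  simp [perm2Tensor, recast_permHom_apply, perm2Pair, permTensor]

theorem perm2Swap_pair {m n : ℕ} (a : Fin (2 ^ m)) (b : Fin (2 ^ n)) :
    perm2Swap m n (perm2Pair a b) = perm2Pair b a := by
  simp [perm2Swap, recast_permHom_apply, perm2Pair, permTensorSymm]

theorem perm2Pair_assoc {l m n : ℕ} (h : 2 ^ (l + m + n) = 2 ^ (l + (m + n))) (a : Fin (2 ^ l))
    (b : Fin (2 ^ m)) (c : Fin (2 ^ n)) :
    Fin.cast h (perm2Pair (perm2Pair a b) c) = perm2Pair a (perm2Pair b c) := by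
  ext
  simp only [Fin.val_cast, perm2Pair_val]
  ring

theorem perm2Pair_assoc_symm {l m n : ℕ} (h : 2 ^ (l + (m + n)) = 2 ^ (l + m + n))
    (a : Fin (2 ^ l)) (b : Fin (2 ^ m)) (c : Fin (2 ^ n)) :
    Fin.cast h (perm2Pair a (perm2Pair b c)) = perm2Pair (perm2Pair a b) c := by
  ext
  simp only [Fin.val_cast, perm2Pair_val]
  ring

/-- The crop `Perm₂`: the object `n` stands for `2 ^ n`, the monoidal product is `⊗`, and the
NOT gate is the symmetry `γ₁,₁` of the direct sum, the transposition of `[2]`. -/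
def perm2 : Crop.{0} where
  Hom m n := PermHom (2 ^ m) (2 ^ n)
  id n := Equiv.refl (Fin (2 ^ n))
  comp f g := f.trans g
  tensor := perm2Tensor
  swap := perm2Swap
  id_comp _ := rfl
  comp_id _ := rfl
  comp_assoc _ _ _ := rfl
  tensor_id m n := by
    refine Equiv.ext fun i => ?_
    obtain ⟨a, b, rfl⟩ := perm2Pair_surj i
    simp [perm2Tensor_pair]
  tensor_comp f g f' g' := by
    refine Equiv.ext fun i => ?_
    obtain ⟨a, b, rfl⟩ := perm2Pair_surj i
    simp [perm2Tensor_pair]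
  tensor_assoc f g h := by
    refine Equiv.ext fun i => ?_
    obtain ⟨a, i, rfl⟩ := perm2Pair_surj i
    obtain ⟨b, c, rfl⟩ := perm2Pair_surj i
    rw [recast_permHom_pow_apply, perm2Pair_assoc_symm]
    simp only [perm2Tensor_pair, perm2Pair_assoc]
  tensor_unit_left {m n} f := by
    refine Equiv.ext fun i => ?_
    have h : Fin.cast (congrArg (2 ^ ·) (Nat.zero_add m).symm) i =
        perm2Pair (0 : Fin (2 ^ 0)) i := by
      ext; simp [perm2Pair_val]
    rw [recast_permHom_pow_apply, h, perm2Tensor_pair]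
    ext; simp [perm2Pair_val]
  tensor_unit_right {m n} f := by
    refine Equiv.ext fun i => ?_
    have h : Fin.cast (congrArg (2 ^ ·) (Nat.add_zero m).symm) i =
        perm2Pair i (0 : Fin (2 ^ 0)) := by
      ext; simp [perm2Pair_val]
    rw [recast_permHom_pow_apply, h, perm2Tensor_pair]
    ext; simp [perm2Pair_val]
  swap_natural f g := by
    refine Equiv.ext fun i => ?_
    obtain ⟨a, b, rfl⟩ := perm2Pair_surj i
    simp [perm2Tensor_pair, perm2Swap_pair]
  swap_swap m n := by
    refine Equiv.ext fun i => ?_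
    obtain ⟨a, b, rfl⟩ := perm2Pair_surj i
    simp [perm2Swap_pair]
  swap_hexagon l m n := by
    refine Equiv.ext fun i => ?_
    obtain ⟨i, c, rfl⟩ := perm2Pair_surj i
    obtain ⟨a, b, rfl⟩ := perm2Pair_surj i
    rw [Equiv.trans_apply, recast_permHom_pow_apply, recast_permHom_pow_apply]
    simp only [perm2Pair_assoc, Fin.cast_eq_self, perm2Swap_pair, perm2Tensor_pair,
      Equiv.refl_apply]
  endo {m n} f := by
    have h : 2 ^ m = 2 ^ n := by simpa using Fintype.card_congr f
    exact Nat.pow_right_injective le_rfl h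
  x := permSumSymm 1 1
  x_comp_x := by
    refine Equiv.ext fun i => ?_
    change finAddFlip (finAddFlip (i : Fin (1 + 1))) = i
    revert i
    decide

/-!
The interpretation `interp : cX → Perm₂` sends `C¹` and `C⁰` to control by the first bit. It is
shown to be bijective on endomorphisms of `n` by induction on `n`.

On `1 + n` wires, `C⁰` and `C¹` give two commuting copies of the endomorphisms of `n`, which by
induction are two copies of the symmetric group on `[2 ^ n]`. Let `t` be the NOT gate on the first
wire that is controlled positively by all the others (`topGate`). It is interpreted by the
transposition of the two copies of the string `p = 1⋯1`. The proof rests on three facts.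

* The symmetric group on two copies of a set is generated by the symmetric groups on the copies and
  such a `t`, subject to these relations: `t` is an involution, it commutes with the stabilizers of
  `p`, and it satisfies the braid relation with each transposition that moves `p`
  (`exists_permHom_bool_prod`). This follows from the presentation of a symmetric group by all its
  transpositions (`exists_permHom_of_swaps`).
* These relations follow from the control equations. The braid relation is the swap rule under
  further controls (`topGate_braid`). For the commutation relation, the stabilizer of `p` is
  generated by gates with a negative control, and these commute with `t`, where the same wire is a
  positive control (`mem_of_fixes_true`, `commute_topGate_succ`).
* All morphisms of `cX` are generated by gates controlled by the first wire and by `t`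
  (`generated_cropX`). An uncontrolled gate on the lower wires is the product of its two controlled
  versions. The NOT gate on the first wire is therefore a product of multiply controlled NOT gates,
  and by the swap rule so are the symmetries.

The presentation yields an inverse of the interpretation on the generators, so the interpretation
is bijective (`bijective_of_generated`).
-/

/-! ### Homomorphisms out of symmetric groups -/

open Equiv in
/-- The step of `exists_permHom_of_swaps` that adds a point to the set: a permutation of `Option β`
is written as `swap none i` times a permutation of `β`. -/
theorem exists_permHom_option {G : Type*} [Group G] {β : Type} [Finite β] [DecidableEq β]
    (ψ : Perm β →* G) (T : Option β → Option β → G) (hone : ∀ a, T a a = 1)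
    (hsymm : ∀ a b, T a b = T b a) (hsq : ∀ a b, T a b * T a b = 1)
    (hconj : ∀ a b c d, T a b * T c d = T (swap a b c) (swap a b d) * T a b)
    (hψ : ∀ a b, ψ (swap a b) = T (some a) (some b)) :
    ∃ Ψ : Perm (Option β) →* G, ∀ a b, Ψ (swap a b) = T a b := by
  have hrefl : (Equiv.refl (Option β) : Perm (Option β)) = 1 := rfl
  have hcongr (σ τ : Perm β) : optionCongr (σ * τ) = optionCongr σ * optionCongr τ := by
    ext1 x
    cases x <;> rfl
  obtain ⟨Ψ, hval⟩ : ∃ Ψ : Perm (Option β) → G, ∀ (i : Option β) (τ : Perm β),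
      Ψ (swap none i * optionCongr τ) = T none i * ψ τ := by
    refine ⟨fun σ => T none (σ none) * ψ (removeNone σ), fun i τ => ?_⟩
    have h := Prod.ext_iff.1 ((Perm.decomposeOption (α := β)).apply_symm_apply (i, τ))
    rw [Perm.decomposeOption_symm_apply] at h
    simp only [Perm.decomposeOption_apply] at h
    simp only [h.1, h.2]
  have hval' (τ : Perm β) : Ψ (optionCongr τ) = ψ τ := by
    have h := hval none τ
    rwa [swap_self, hrefl, one_mul, hone, one_mul] at h
  have hsome (a b : β) (i : Option β) (τ : Perm β) :
      Ψ (swap (some a) (some b) * (swap none i * optionCongr τ)) =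
        T (some a) (some b) * Ψ (swap none i * optionCongr τ) := by
    have hfix : swap (some a) (some b) none = none := swap_apply_of_ne_of_ne (by simp) (by simp)
    have h : swap (some a) (some b) * (swap none i * optionCongr τ) =
        swap none (swap (some a) (some b) i) * optionCongr (swap a b * τ) := by
      have h₁ := swap_apply_apply (swap (some a) (some b)) none i
      rw [hfix] at h₁
      rw [h₁, hcongr, optionCongr_swap]
      group
    rw [h, hval, hval, map_mul, hψ, ← mul_assoc, ← mul_assoc, hconj (some a), hfix]
  have hnone (b : β) (i : Option β) (τ : Perm β) :
      Ψ (swap none (some b) * (swap none i * optionCongr τ)) =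
        T none (some b) * Ψ (swap none i * optionCongr τ) := by
    rcases i with _ | i
    · rw [swap_self, hrefl, one_mul, hval, hval']
    by_cases hib : i = b
    · subst hib
      rw [← mul_assoc, swap_mul_self, one_mul, hval, ← mul_assoc, hsq, one_mul, hval']
    · have hfix : swap none (some i) (some b) = some b :=
        swap_apply_of_ne_of_ne (by simp) (by simpa using Ne.symm hib)
      have h₅ : swap none (some b) * swap none (some i) =
          swap none (some i) * swap (some i) (some b) := by
        have h := swap_apply_apply (swap none (some i)) (some i) (some b)
        rw [swap_apply_right, hfix] at h
        rw [h]
        group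
      have h₆ : T none (some b) * T none (some i) = T none (some i) * T (some i) (some b) := by
        rw [hconj none (some i), swap_apply_right, hfix]
      rw [← mul_assoc, h₅, mul_assoc, ← optionCongr_swap, ← hcongr, hval, hval, map_mul, hψ,
        ← mul_assoc, ← mul_assoc, h₆]
  have hΨone : Ψ 1 = 1 := by
    rw [← optionCongr_one, hval', map_one]
  have hΨmul (a b : Option β) (σ : Perm (Option β)) : Ψ (swap a b * σ) = T a b * Ψ σ := by
    obtain ⟨i, τ, rfl⟩ : ∃ i τ, σ = swap none i * optionCongr τ :=
      ⟨_, _, ((Perm.decomposeOption (α := β)).symm_apply_apply σ).symm⟩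
    rcases a with _ | a <;> rcases b with _ | b
    · rw [swap_self, hone, one_mul]; rfl
    · exact hnone b i τ
    · rw [swap_comm, hsymm]; exact hnone a i τ
    · exact hsome a b i τ
  refine ⟨MonoidHom.mk' Ψ fun σ τ => ?_, fun a b => ?_⟩
  · induction σ using Perm.swap_induction_on with
    | one => rw [one_mul, hΨone, one_mul]
    | swap_mul σ a b _ h => rw [mul_assoc, hΨmul, h, hΨmul, mul_assoc]
  · have := hΨmul a b 1
    rwa [mul_one, hΨone, mul_one] at this

open Equiv in
/-- The symmetric group is presented by all its transpositions, subject to the conjugation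
relations. The argument `T a b` is the prescribed image of the transposition of `a` and `b`. -/
theorem exists_permHom_of_swaps {G : Type*} [Group G] (β : Type) [Finite β] [DecidableEq β]
    (T : β → β → G) (hone : ∀ a, T a a = 1) (hsymm : ∀ a b, T a b = T b a)
    (hsq : ∀ a b, T a b * T a b = 1)
    (hconj : ∀ a b c d, T a b * T c d = T (swap a b c) (swap a b d) * T a b) :
    ∃ ψ : Perm β →* G, ∀ a b, ψ (swap a b) = T a b := by
  revert T
  rename DecidableEq β => inst
  revert inst
  induction β using Finite.induction_empty_option with
  | @of_equiv α β e ih =>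
    intro _ T hone hsymm hsq hconj
    let _ : DecidableEq α := Classical.decEq α
    obtain ⟨ψ, hψ⟩ := ih (fun a b => T (e a) (e b)) (fun _ => hone _) (fun _ _ => hsymm _ _)
      (fun _ _ => hsq _ _) (fun a b c d => by
        rw [hconj]
        congr 2 <;> simp only [swap_apply_def, EmbeddingLike.apply_eq_iff_eq] <;> split_ifs <;> rfl)
    refine ⟨ψ.comp e.symm.permCongrHom.toMonoidHom, fun a b => ?_⟩
    have : e.symm.permCongrHom (swap a b) = swap (e.symm a) (e.symm b) :=
      (symm_trans_swap_trans a b e.symm)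
    change ψ (e.symm.permCongrHom (swap a b)) = _
    rw [this, hψ, apply_symm_apply, apply_symm_apply]
  | h_empty =>
    intro _ T _ _ _ _
    exact ⟨1, fun a => a.elim⟩
  | @h_option β _ ih =>
    intro inst T hone hsymm hsq hconj
    let _ : DecidableEq β := Classical.decEq β
    obtain rfl : inst = fun a b => Option.instDecidableEq a b := Subsingleton.elim _ _
    obtain ⟨ψ, hψ⟩ := ih (fun a b => T (some a) (some b)) (fun _ => hone _) (fun _ _ => hsymm _ _)
      (fun _ _ => hsq _ _) (fun a b c d => by
        rw [hconj]
        congr 2 <;> simp only [swap_apply_def, Option.some.injEq] <;> split_ifs <;> rfl)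
    exact exists_permHom_option ψ T hone hsymm hsq hconj hψ

/-- In the braid relations of type `A₃`, the conjugate of the middle generator by both outer ones
commutes with the middle generator. -/
theorem commute_of_braid {G : Type*} [Group G] {a b d : G} (ha : a * a = 1) (hb : b * b = 1)
    (had : a * d = d * a) (hab : a * b * a = b * a * b)
    (hbd : d * b * d = b * d * b) : b * (a * d * b * (d * a)) = a * d * b * (d * a) * b := by
  have ha' : a⁻¹ = a := inv_eq_of_mul_eq_one_left ha
  have hb' : b⁻¹ = b := inv_eq_of_mul_eq_one_left hb
  have e₁ : a * d * b * (d * a) = a * b * d * (b * a) := by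
    calc a * d * b * (d * a) = a * (d * b * d) * a := by group
      _ = a * b * d * (b * a) := by rw [hbd]; group
  have e₂ : b * a * b * a = a * b := by
    rw [← hab, mul_assoc, ha, mul_one]
  have e₃ : b * (a * b * d * (b * a)) * b = a * d * b * (d * a) := by
    calc b * (a * b * d * (b * a)) * b = b * a * b * d * (b * a * b) := by group
      _ = a * b * (a * d) * (a * b * a) := by rw [← hab]; group
      _ = a * b * d * (a * a) * (b * a) := by rw [had]; group
      _ = a * (b * d * b) * a := by rw [ha]; group
      _ = a * d * b * (d * a) := by rw [← hbd]; group
  have e₄ : b * (a * d * b * (d * a)) * b = a * d * b * (d * a) := by rw [e₁, e₃, e₁]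
  calc b * (a * d * b * (d * a)) = b * (a * d * b * (d * a)) * (b * b) := by rw [hb, mul_one]
    _ = b * (a * d * b * (d * a)) * b * b := by group
    _ = _ := by rw [e₄]

section BoolProd

open Equiv Equiv.Perm

theorem prodExtendRight_false_apply_true {α : Type} (g : Perm α) (x : α) :
    prodExtendRight false g (true, x) = (true, x) :=
  prodExtendRight_apply_ne _ (by simp) _

theorem prodExtendRight_true_apply_false {α : Type} (g : Perm α) (x : α) :
    prodExtendRight true g (false, x) = (false, x) :=
  prodExtendRight_apply_ne _ (by simp) _

variable {α : Type} [DecidableEq α]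

theorem prodExtendRight_swap (b : Bool) (x y : α) :
    prodExtendRight b (swap x y) = swap (b, x) (b, y) := by
  ext1 ⟨b', z⟩
  by_cases h : b' = b
  · subst h
    rw [prodExtendRight_apply_eq]
    simp only [swap_apply_def, Prod.mk.injEq, true_and]
    split_ifs <;> rfl
  · rw [prodExtendRight_apply_ne _ h, swap_apply_of_ne_of_ne] <;> simp [h]

/-- A transposition of points in the two copies of `α` is a conjugate of any other. -/
theorem swap_false_true_eq_conj (p q x y : α) : swap (false, x) (true, y) =
    prodExtendRight false (swap p x) * prodExtendRight true (swap q y) *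
      swap (false, p) (true, q) *
      (prodExtendRight false (swap p x) * prodExtendRight true (swap q y))⁻¹ := by
  rw [← swap_apply_apply]
  simp [prodExtendRight_apply_eq, prodExtendRight_false_apply_true,
    prodExtendRight_true_apply_false]

/-- A presentation of the symmetric group on two copies of `α` over the two symmetric groups on
`α`: one adjoins the transposition `t` of the two copies of a point `p`, which commutes with the
stabilizers of `p` and satisfies the braid relation with the transpositions that move `p`. -/
theorem exists_permHom_bool_prod {G : Type*} [Group G] [Finite α] (p : α)
    (c : Bool → Perm α →* G) (t : G) (hc : ∀ g h, Commute (c false g) (c true h))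
    (ht : t * t = 1) (hstab : ∀ b g, g p = p → Commute (c b g) t)
    (hbraid : ∀ b q, q ≠ p →
      c b (swap p q) * t * c b (swap p q) = t * c b (swap p q) * t) :
    ∃ ψ : Perm (Bool × α) →* G, (∀ b g, ψ (prodExtendRight b g) = c b g) ∧
      ψ (swap (false, p) (true, p)) = t := by
  let Γ : Perm α × Perm α →* G := (c false).noncommCoprod (c true) hc
  have hΓ (g h : Perm α) : Γ (g, h) = c false g * c true h := rfl
  -- The prescribed image of the transposition of `(false, x)` and `(true, y)`.
  let U : α → α → G := fun x y => Γ (swap p x, swap p y) * t * (Γ (swap p x, swap p y))⁻¹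
  have hΓU (g h : Perm α) : Γ (g, h) * t * (Γ (g, h))⁻¹ = U (g p) (h p) := by
    have hcomm : Commute (Γ ((swap p (g p), swap p (h p))⁻¹ * (g, h))) t := by
      refine Commute.mul_left (hstab false _ ?_) (hstab true _ ?_) <;> simp
    rw [map_mul, map_inv] at hcomm
    have hcomm := hcomm.eq
    simp only [U]
    generalize Γ (g, h) = a at *
    generalize Γ (swap p (g p), swap p _) = b at *
    rw [mul_inv_eq_iff_eq_mul, ← mul_right_inj b⁻¹, ← mul_assoc, hcomm]
    group
  have hU (x y : α) : Γ (swap p x, swap p y) * t * (Γ (swap p x, swap p y))⁻¹ = U x y := rfl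
  let T : Bool × α → Bool × α → G
    | (false, x), (false, y) => c false (swap x y)
    | (true, x), (true, y) => c true (swap x y)
    | (false, x), (true, y) => U x y
    | (true, x), (false, y) => U y x
  have hTff (x y : α) : T (false, x) (false, y) = c false (swap x y) := rfl
  have hTtt (x y : α) : T (true, x) (true, y) = c true (swap x y) := rfl
  have hTft (x y : α) : T (false, x) (true, y) = U x y := rfl
  have hTtf (x y : α) : T (true, x) (false, y) = U y x := rfl
  have hrefl : (Equiv.refl α : Perm α) = 1 := rfl
  have hTone (x : Bool × α) : T x x = 1 := by
    obtain ⟨_ | _, x⟩ := x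
    · rw [hTff, swap_self, hrefl, map_one]
    · rw [hTtt, swap_self, hrefl, map_one]
  have hTsymm (x y : Bool × α) : T x y = T y x := by
    obtain ⟨_ | _, x⟩ := x <;> obtain ⟨_ | _, y⟩ := y
    · rw [hTff, hTff, swap_comm]
    · rfl
    · rfl
    · rw [hTtt, hTtt, swap_comm]
  have hTsq (x y : Bool × α) : T x y * T x y = 1 := by
    have hUsq (x y : α) : U x y * U x y = 1 := by
      rw [← hU, conj_mul, ht, mul_one, mul_inv_cancel]
    obtain ⟨_ | _, x⟩ := x <;> obtain ⟨_ | _, y⟩ := y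
    · rw [hTff, ← map_mul, swap_mul_self, map_one]
    · exact hUsq _ _
    · exact hUsq _ _
    · rw [hTtt, ← map_mul, swap_mul_self, map_one]
  -- `T` is equivariant for the two symmetric groups on `α`.
  have hΓeq (g h : Perm α) (x y : α) : Γ (g, h) * U x y = U (g x) (h y) * Γ (g, h) := by
    have h₁ := hΓU (g * swap p x) (h * swap p y)
    rw [Perm.mul_apply, Perm.mul_apply, swap_apply_left, swap_apply_left, ← Prod.mk_mul_mk,
      map_mul] at h₁
    rw [← h₁, ← hU]
    group
  have heq (b : Bool) (g : Perm α) (z w : Bool × α) :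
      c b g * T z w = T (prodExtendRight b g z) (prodExtendRight b g w) * c b g := by
    have hswap (b : Bool) (x y : α) :
        c b g * c b (swap x y) = c b (swap (g x) (g y)) * c b g := by
      rw [← map_mul, ← map_mul, swap_apply_apply, inv_mul_cancel_right]
    have h₁ : Γ (g, 1) = c false g := by rw [hΓ, map_one, mul_one]
    have h₂ : Γ (1, g) = c true g := by rw [hΓ, map_one, one_mul]
    obtain ⟨_ | _, x⟩ := z <;> obtain ⟨_ | _, y⟩ := w <;> cases b <;>
      simp only [prodExtendRight_apply_eq, prodExtendRight_false_apply_true,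
        prodExtendRight_true_apply_false]
    · exact hswap _ _ _
    · exact (hc _ _).symm.eq
    · rw [hTft, hTft, ← h₁, hΓeq, Perm.one_apply]
    · rw [hTft, hTft, ← h₂, hΓeq, Perm.one_apply]
    · rw [hTtf, hTtf, ← h₁, hΓeq, Perm.one_apply]
    · rw [hTtf, hTtf, ← h₂, hΓeq, Perm.one_apply]
    · exact (hc _ _).eq
    · exact hswap _ _ _
  have hUpp : U p p = t := by
    rw [← hU, swap_self, hrefl, show ((1 : Perm α), (1 : Perm α)) = 1 from rfl, map_one]
    group
  have hcinv (b : Bool) (x y : α) : (c b (swap x y))⁻¹ = c b (swap x y) := by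
    rw [← map_inv, swap_inv]
  have hUp (x : α) : U x p = c false (swap p x) * t * c false (swap p x) := by
    rw [← hU, swap_self, hrefl, hΓ, map_one, mul_one, hcinv]
  have hpU (x : α) : U p x = c true (swap p x) * t * c true (swap p x) := by
    rw [← hU, swap_self, hrefl, hΓ, map_one, one_mul, hcinv]
  have htc (b : Bool) (x : α) (hx : x ≠ p) :
      t * c b (swap p x) = c b (swap p x) * t * c b (swap p x) * t := by
    rw [hbraid b x hx, mul_assoc _ t t, ht, mul_one]
  have htU (b : Bool) (x : α) (hx : x ≠ p) :
      t * (c b (swap p x) * t * c b (swap p x)) = c b (swap p x) * t := by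
    rw [hbraid b x hx, ← mul_assoc, ← mul_assoc, ht, one_mul]
  have htUU (x y : α) (hx : x ≠ p) (hy : y ≠ p) : t * U x y = U x y * t := by
    have hsq (b : Bool) (x y : α) : c b (swap x y) * c b (swap x y) = 1 := by
      rw [← map_mul, swap_mul_self, map_one]
    rw [← hU, hΓ, mul_inv_rev, hcinv, hcinv]
    exact commute_of_braid (hsq _ _ _) ht (hc _ _).eq (hbraid _ _ hx) (hbraid _ _ hy)
  have htcomm (b : Bool) (x y : α) (hx : x ≠ p) (hy : y ≠ p) :
      t * c b (swap x y) = c b (swap x y) * t :=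
    (hstab b _ (swap_apply_of_ne_of_ne hx.symm hy.symm)).symm.eq
  have hs (b : Bool) (x : α) (hx : x ≠ p) : swap (false, p) (true, p) (b, x) = (b, x) :=
    swap_apply_of_ne_of_ne (by simp [hx]) (by simp [hx])
  -- The conjugation relation for the transposition of the two copies of `p`.
  have hbase (z w : Bool × α) :
      t * T z w = T (swap (false, p) (true, p) z) (swap (false, p) (true, p) w) * t := by
    obtain ⟨b, x⟩ := z
    obtain ⟨b', y⟩ := w
    by_cases hx : x = p <;> by_cases hy : y = p
    · subst hx; subst hy
      cases b <;> cases b' <;>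
        simp only [swap_apply_left, swap_apply_right, hTone, hTft, hTtf, hUpp, one_mul, mul_one]
    · subst hx
      cases b <;> cases b' <;>
        simp only [swap_apply_left, swap_apply_right, hs _ _ hy, hTff, hTtt, hTft, hTtf, hUp, hpU,
          htc _ _ hy, htU _ _ hy]
    · subst hy
      cases b <;> cases b' <;>
        simp only [swap_apply_left, swap_apply_right, hs _ _ hx, hTff, hTtt, hTft, hTtf, hUp, hpU,
          swap_comm x, htc _ _ hx, htU _ _ hx]
    · cases b <;> cases b' <;>
        simp only [hs _ _ hx, hs _ _ hy, hTff, hTtt, hTft, hTtf, htUU _ _ hx hy, htUU _ _ hy hx,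
          htcomm _ _ _ hx hy]
  -- By equivariance, it holds for all transpositions of points in different copies.
  have hcross (x y : α) (z w : Bool × α) :
      U x y * T z w =
        T (swap (false, x) (true, y) z) (swap (false, x) (true, y) w) * U x y := by
    let f : Perm (Bool × α) :=
      prodExtendRight false (swap p x) * prodExtendRight true (swap p y)
    have hfΓ (z w : Bool × α) : Γ (swap p x, swap p y) * T z w =
        T (f z) (f w) * Γ (swap p x, swap p y) := by
      rw [hΓ, mul_assoc, heq, ← mul_assoc, heq, mul_assoc]
      rfl
    have hfs : swap (false, x) (true, y) = f * swap (false, p) (true, p) * f⁻¹ :=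
      swap_false_true_eq_conj p p x y
    obtain ⟨z, rfl⟩ := f.surjective z
    obtain ⟨w, rfl⟩ := f.surjective w
    have e := hfΓ z w
    have e' := hfΓ (swap (false, p) (true, p) z) (swap (false, p) (true, p) w)
    have happ (z : Bool × α) : (f * swap (false, p) (true, p) * f⁻¹) (f z) =
        f (swap (false, p) (true, p) z) := by
      rw [← Perm.mul_apply, inv_mul_cancel_right, Perm.mul_apply]
    rw [hfs, ← hU, happ, happ]
    rw [← mul_inv_eq_iff_eq_mul] at e e'
    rw [← e, ← e']
    have := hbase z w
    calc _ = Γ (swap p x, swap p y) * (t * T z w) * (Γ (swap p x, swap p y))⁻¹ := by group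
      _ = _ := by rw [this]; group
  have hconj (x y z w : Bool × α) : T x y * T z w = T (swap x y z) (swap x y w) * T x y := by
    obtain ⟨_ | _, x⟩ := x <;> obtain ⟨_ | _, y⟩ := y
    · rw [hTff, heq, prodExtendRight_swap]
    · exact hcross x y z w
    · rw [swap_comm]; exact hcross y x z w
    · rw [hTtt, heq, prodExtendRight_swap]
  obtain ⟨ψ, hψ⟩ := exists_permHom_of_swaps (Bool × α) T hTone hTsymm hTsq hconj
  refine ⟨ψ, fun b g => ?_, by rw [hψ, hTft, hUpp]⟩
  induction g using Perm.swap_induction_on with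
  | one =>
    rw [map_one, ← map_one ψ]
    congr 1
    ext1 ⟨b', z⟩
    by_cases h : b' = b
    · subst h; rw [prodExtendRight_apply_eq]; rfl
    · rw [prodExtendRight_apply_ne _ h]; rfl
  | swap_mul g x y _ ih =>
    have : prodExtendRight b (swap x y * g) = swap (b, x) (b, y) * prodExtendRight b g := by
      rw [← prodExtendRight_swap]
      ext1 ⟨b', z⟩
      by_cases h : b' = b
      · subst h; simp [prodExtendRight_apply_eq]
      · simp [prodExtendRight_apply_ne _ h]
    rw [this, map_mul, map_mul, ih, hψ]
    cases b <;> rfl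

/-- The stabilizer of `(true, p)` in the symmetric group on two copies of `α` is generated by the
symmetric group on the first copy, the stabilizer of `p` in the one on the second copy, and the
transposition of the two copies of some other point, if there is one. -/
theorem mem_of_fixes_true [Finite α] (p : α) (M : Subgroup (Perm (Bool × α)))
    (hfalse : ∀ g, prodExtendRight false g ∈ M)
    (htrue : ∀ g : Perm α, g p = p → prodExtendRight true g ∈ M)
    (hswap : ∀ r, r ≠ p → ∃ r', r' ≠ p ∧ swap (false, r') (true, r') ∈ M)
    (σ : Perm (Bool × α)) (hσ : σ (true, p) = (true, p)) : σ ∈ M := by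
  have hcross (x y : α) (hy : y ≠ p) : swap (false, x) (true, y) ∈ M := by
    obtain ⟨r, hr, hM⟩ := hswap y hy
    have h₁ : prodExtendRight false (swap r x) * prodExtendRight true (swap r y) ∈ M :=
      mul_mem (hfalse _) (htrue _ (swap_apply_of_ne_of_ne hr.symm hy.symm))
    rw [swap_false_true_eq_conj r r]
    exact mul_mem (mul_mem h₁ hM) (inv_mem h₁)
  have hall (z w : Bool × α) (hz : z ≠ (true, p)) (hw : w ≠ (true, p)) : swap z w ∈ M := by
    obtain ⟨_ | _, x⟩ := z <;> obtain ⟨_ | _, y⟩ := w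
    · rw [← prodExtendRight_swap]; exact hfalse _
    · exact hcross x y (by simpa using hw)
    · rw [swap_comm]; exact hcross y x (by simpa using hz)
    · rw [← prodExtendRight_swap]
      refine htrue _ (swap_apply_of_ne_of_ne ?_ ?_) <;> rintro rfl <;> contradiction
  have hsub (τ : Perm {z : Bool × α // z ≠ (true, p)}) : ofSubtype τ ∈ M := by
    induction τ using Perm.swap_induction_on with
    | one => rw [map_one]; exact one_mem M
    | swap_mul τ x y _ ih =>
      rw [map_mul, ofSubtype_swap_eq]
      exact mul_mem (hall _ _ x.2 y.2) ih
  have hiff (z : Bool × α) : σ z ≠ (true, p) ↔ z ≠ (true, p) := by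
    rw [not_iff_not, ← hσ, EmbeddingLike.apply_eq_iff_eq, hσ]
  rw [← ofSubtype_subtypePerm (f := σ) (p := (· ≠ (true, p))) hiff (by
    rintro z hz rfl
    exact hz hσ)]
  exact hsub _

/-- A monoid that is generated by two commuting copies of the symmetric group on `α` and an
involution `t` is the symmetric group on two copies of `α`, provided it satisfies the relations of
`exists_permHom_bool_prod`. -/
theorem bijective_of_generated {A G : Type*} [Monoid A] [Monoid G] [Finite α]
    (φA : A →* Perm α) (hφA : Function.Bijective φA) (φ : G →* Perm (Bool × α))
    (C : Bool → A →* G) (hC : ∀ b a, φ (C b a) = prodExtendRight b (φA a))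
    (hcomm : ∀ a a', Commute (C false a) (C true a')) (p : α) (t : G)
    (hφt : φ t = swap (false, p) (true, p)) (ht : t * t = 1)
    (hstab : ∀ b a, φA a p = p → Commute (C b a) t)
    (hbraid : ∀ q, q ≠ p → ∃ q' a, q' ≠ p ∧ φA a = swap p q' ∧
      ∀ b, C b a * t * C b a = t * C b a * t)
    (hgen : Submonoid.closure (Set.range (C false) ∪ Set.range (C true) ∪ {t}) = ⊤) :
    Function.Bijective φ := by
  let e : A ≃* Perm α := MulEquiv.ofBijective φA hφA
  have he (a : A) : e.symm (φA a) = a := e.symm_apply_apply a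
  have he' (g : Perm α) : φA (e.symm g) = g := e.apply_symm_apply g
  let c : Bool → Perm α →* Gˣ := fun b => ((C b).comp e.symm.toMonoidHom).toHomUnits
  have hc (b : Bool) (g : Perm α) : (c b g : G) = C b (e.symm g) := rfl
  let u : Gˣ := ⟨t, t, ht, ht⟩
  have hu : (u : G) = t := rfl
  have hcstab (b : Bool) (g : Perm α) (hg : g p = p) : Commute (c b g) u := by
    exact Units.ext (hstab b (e.symm g) (by rwa [he']))
  obtain ⟨ψ, hψc, hψu⟩ := exists_permHom_bool_prod p c u
    (fun g h => Units.ext (hcomm _ _))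
    (Units.ext ht) hcstab (fun b q hq => by
      obtain ⟨q', a, hq', ha, hbr⟩ := hbraid q hq
      have h₁ : c b (swap p q') * u * c b (swap p q') = u * c b (swap p q') * u := by
        rw [← ha]
        refine Units.ext ?_
        simp only [Units.val_mul, hc, he, hu]
        exact hbr b
      -- The transposition of `p` and `q` is a conjugate of that of `p` and `q'` by an element
      -- of the stabilizer of `p`.
      have h₂ : swap p q = swap q' q * swap p q' * (swap q' q)⁻¹ := by
        rw [← swap_apply_apply, swap_apply_left, swap_apply_of_ne_of_ne hq'.symm hq.symm]
      have h₃ := (hcstab b (swap q' q) (swap_apply_of_ne_of_ne hq'.symm hq.symm)).eq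
      rw [h₂, map_mul, map_mul, map_inv]
      generalize c b (swap p q') = x at *
      generalize c b (swap q' q) = y at *
      have h₄ : y⁻¹ * u * y = u := by rw [mul_assoc, ← h₃]; group
      have h₅ : y * u * y⁻¹ = u := by rw [h₃]; group
      calc y * x * y⁻¹ * u * (y * x * y⁻¹) = y * (x * (y⁻¹ * u * y) * x) * y⁻¹ := by group
        _ = (y * u * y⁻¹) * (y * x * y⁻¹) * (y * u * y⁻¹) := by rw [h₄, h₁]; group
        _ = _ := by rw [h₅])
  have hψφ : (Units.coeHom G).comp (ψ.comp φ) = MonoidHom.id G := by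
    refine MonoidHom.eq_of_eqOn_denseM hgen ?_
    rintro _ ((⟨a, rfl⟩ | ⟨a, rfl⟩) | ht')
    · change ((ψ (φ (C false a)) : Gˣ) : G) = _
      rw [hC, hψc, hc, he]; rfl
    · change ((ψ (φ (C true a)) : Gˣ) : G) = _
      rw [hC, hψc, hc, he]; rfl
    · rw [Set.mem_singleton_iff.1 ht']
      change ((ψ (φ t) : Gˣ) : G) = _
      rw [hφt, hψu]; rfl
  refine ⟨Function.LeftInverse.injective (g := fun σ => ((ψ σ : Gˣ) : G))
    fun g => DFunLike.congr_fun hψφ g, fun σ => ?_⟩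
  have hext (b : Bool) (g : Perm α) : prodExtendRight b g ∈ MonoidHom.mrange φ :=
    ⟨C b (e.symm g), by rw [hC, he']⟩
  have hcross (x y : α) : swap (false, x) (true, y) ∈ MonoidHom.mrange φ := by
    rw [swap_false_true_eq_conj p p, mul_inv_rev, prodExtendRight_swap, prodExtendRight_swap,
      swap_inv, swap_inv, ← prodExtendRight_swap, ← prodExtendRight_swap]
    exact mul_mem (mul_mem (mul_mem (hext _ _) (hext _ _)) ⟨t, hφt⟩)
      (mul_mem (hext _ _) (hext _ _))
  induction σ using Perm.swap_induction_on with
  | one => exact ⟨1, map_one φ⟩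
  | swap_mul σ z w _ ih =>
    have hzw : swap z w ∈ MonoidHom.mrange φ := by
      obtain ⟨_ | _, x⟩ := z <;> obtain ⟨_ | _, y⟩ := w
      · rw [← prodExtendRight_swap]; exact hext _ _
      · exact hcross x y
      · rw [swap_comm]; exact hcross y x
      · rw [← prodExtendRight_swap]; exact hext _ _
    exact (MonoidHom.mrange φ).mul_mem hzw ih

end BoolProd

/-! ### The monoids of endomorphisms in a prop -/

section Recast

variable {F : ℕ → ℕ → Type u}

theorem recast_recast {m n m' n' m'' n'' : ℕ} (f : F m n) (hm : m = m') (hn : n = n')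
    (hm' : m' = m'') (hn' : n' = n'') :
    recast (recast f hm hn) hm' hn' = recast f (hm.trans hm') (hn.trans hn') := by
  subst hm hn hm' hn'; rfl

end Recast

namespace PROP

variable (Q : PROP.{u})

theorem recast_comp {l m n l' m' n' : ℕ} (f : Q.Hom l m) (g : Q.Hom m n) (hl : l = l')
    (hm : m = m') (hn : n = n') :
    Q.comp (recast f hl hm) (recast g hm hn) = recast (Q.comp f g) hl hn := by
  subst hl hm hn; rfl

/-- Endomorphisms form a monoid under composition, in the order of composition of functions. -/
instance endMonoid (n : ℕ) : Monoid (Q.Hom n n) where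
  mul f g := Q.comp g f
  mul_assoc f g h := (Q.comp_assoc h g f).symm
  one := Q.id n
  one_mul := Q.comp_id
  mul_one := Q.id_comp

/-- Transport of endomorphisms along an equality of objects. -/
def castHom {m n : ℕ} (h : m = n) : Q.Hom m m →* Q.Hom n n where
  toFun f := recast f h h
  map_one' := by subst h; rfl
  map_mul' f g := by subst h; rfl

theorem castHom_castHom {l m n : ℕ} (h : l = m) (h' : m = n) (f : Q.Hom l l) :
    Q.castHom h' (Q.castHom h f) = Q.castHom (h.trans h') f := by
  subst h h'; rfl

/-- The monoidal product with `m` identity wires on the right. -/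
def padRight (m : ℕ) {n : ℕ} : Q.Hom n n →* Q.Hom (n + m) (n + m) where
  toFun f := Q.tensor f (Q.id m)
  map_one' := Q.tensor_id n m
  map_mul' f g := by
    change Q.tensor (Q.comp g f) (Q.id m) = Q.comp _ _
    rw [← Q.tensor_comp, Q.id_comp]

/-- The monoidal product with one identity wire on the left. -/
def under {n : ℕ} : Q.Hom n n →* Q.Hom (1 + n) (1 + n) where
  toFun f := Q.tensor (Q.id 1) f
  map_one' := Q.tensor_id 1 n
  map_mul' f g := by
    change Q.tensor (Q.id 1) (Q.comp g f) = Q.comp _ _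
    rw [← Q.tensor_comp, Q.id_comp]

theorem padRight_castHom {k m n : ℕ} (h : m = n) (f : Q.Hom m m) :
    Q.padRight k (Q.castHom h f) = Q.castHom (congrArg (· + k) h) (Q.padRight k f) := by
  subst h; rfl

theorem under_castHom {m n : ℕ} (h : m = n) (f : Q.Hom m m) :
    Q.under (Q.castHom h f) = Q.castHom (congrArg (1 + ·) h) (Q.under f) := by
  subst h; rfl

theorem castHom_padRight_under {k : ℕ} (n : ℕ) (f : Q.Hom k k) :
    Q.castHom (Nat.add_assoc 1 k n) (Q.padRight n (Q.under f)) = Q.under (Q.padRight n f) :=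
  Q.tensor_assoc (Q.id 1) f (Q.id n)

theorem castHom_padRight_padRight {k : ℕ} (m n : ℕ) (f : Q.Hom k k) :
    Q.castHom (Nat.add_assoc k m n) (Q.padRight n (Q.padRight m f)) = Q.padRight (m + n) f := by
  refine (Q.tensor_assoc f (Q.id m) (Q.id n)).trans ?_
  rw [Q.tensor_id]
  rfl

/-- The symmetry of the first two of `2 + n` wires. -/
def flip (n : ℕ) : Q.Hom (1 + (1 + n)) (1 + (1 + n)) :=
  Q.castHom (Nat.add_assoc 1 1 n) (Q.padRight n (Q.swap 1 1))

theorem swap_one_mul_self : (Q.swap 1 1 : Q.Hom (1 + 1) (1 + 1)) * Q.swap 1 1 = 1 :=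
  Q.swap_swap 1 1

theorem flip_mul_self (n : ℕ) : Q.flip n * Q.flip n = 1 := by
  rw [flip, ← map_mul, ← map_mul, swap_one_mul_self, map_one, map_one]

/-- The symmetry of the first two wires exchanges the gates `f` on these wires. -/
theorem flip_mul_under (n : ℕ) (f : Q.Hom 1 1) :
    Q.flip n * Q.under (Q.padRight n f) * Q.flip n = Q.padRight (1 + n) f := by
  rw [flip, ← castHom_padRight_under, ← map_mul, ← map_mul, ← map_mul, ← map_mul,
    ← castHom_padRight_padRight]
  congr 2
  have h : (Q.swap 1 1 : Q.Hom (1 + 1) (1 + 1)) * Q.under f = Q.padRight 1 f * Q.swap 1 1 :=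
    Q.swap_natural (Q.id 1) f
  rw [h, mul_assoc, swap_one_mul_self, mul_one]

theorem flip_one_braid : Q.flip 1 * Q.under (Q.swap 1 1) * Q.flip 1 =
    Q.under (Q.swap 1 1) * Q.flip 1 * Q.under (Q.swap 1 1) := by
  have hex : (Q.swap 1 (1 + 1) : Q.Hom (1 + (1 + 1)) (1 + (1 + 1))) =
      Q.under (Q.swap 1 1) * Q.flip 1 := Q.swap_hexagon 1 1 1
  have nat : (Q.swap 1 (1 + 1) : Q.Hom (1 + (1 + 1)) (1 + (1 + 1))) * Q.under (Q.swap 1 1) =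
      Q.flip 1 * (Q.swap 1 (1 + 1) : Q.Hom (1 + (1 + 1)) (1 + (1 + 1))) :=
    Q.swap_natural (Q.id 1) (Q.swap 1 1)
  rw [hex] at nat
  rw [mul_assoc, ← nat]

/-- The braid relation for symmetries of neighbouring wires. -/
theorem flip_braid (n : ℕ) : Q.flip (1 + n) * Q.under (Q.flip n) * Q.flip (1 + n) =
    Q.under (Q.flip n) * Q.flip (1 + n) * Q.under (Q.flip n) := by
  have h₁ : Q.flip (1 + n) =
      Q.castHom (by ring : 1 + (1 + 1) + n = 1 + (1 + (1 + n))) (Q.padRight n (Q.flip 1)) := by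
    rw [flip, flip, padRight_castHom, castHom_castHom, ← castHom_padRight_padRight,
      castHom_castHom]
  have h₂ : Q.under (Q.flip n) = Q.castHom (by ring : 1 + (1 + 1) + n = 1 + (1 + (1 + n)))
      (Q.padRight n (Q.under (Q.swap 1 1))) := by
    rw [flip, under_castHom, ← castHom_padRight_under, castHom_castHom]
  rw [h₁, h₂, ← map_mul, ← map_mul, ← map_mul, ← map_mul, flip_one_braid]
  simp only [map_mul]

end PROP

/-! ### Crops with control operations -/

/-- A crop with operations `C⁰` (`ctrl false`) and `C¹` (`ctrl true`) that satisfy the control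
equations. -/
structure ControlCrop extends Crop.{u} where
  ctrl (b : Bool) {n : ℕ} (f : Hom n n) : Hom (1 + n) (1 + n)
  ctrl_comp {n : ℕ} (f g : Hom n n) :
    ctrl true (comp f g) = comp (ctrl true f) (ctrl true g)
  ctrl_id (n : ℕ) : ctrl true (id n) = id (1 + n)
  strength {n : ℕ} (f : Hom n n) (m : ℕ) :
    recast (ctrl true (tensor f (id m))) (Nat.add_assoc 1 n m).symm (Nat.add_assoc 1 n m).symm =
      tensor (ctrl true f) (id m)
  colour {n : ℕ} (f : Hom n n) :
    comp (comp (tensor x (id n)) (ctrl false f)) (tensor x (id n)) = ctrl true f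
  complementarity {n : ℕ} (f : Hom n n) : comp (ctrl true f) (ctrl false f) = tensor (id 1) f
  commutativity {n : ℕ} (f₁ f₂ : Hom n n) :
    comp (ctrl true f₂) (ctrl false f₁) = comp (ctrl false f₁) (ctrl true f₂)
  swap_rule :
    comp (comp (comp (comp (ctrl true x) (swap 1 1)) (ctrl true x)) (swap 1 1)) (ctrl true x) =
      swap 1 1
  swap_coherence {n : ℕ} (f : Hom n n) :
    comp (ctrl true (ctrl true f))
        (recast (tensor (swap 1 1) (id n)) (Nat.add_assoc 1 1 n) (Nat.add_assoc 1 1 n)) =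
      comp (recast (tensor (swap 1 1) (id n)) (Nat.add_assoc 1 1 n) (Nat.add_assoc 1 1 n))
        (ctrl true (ctrl true f))

namespace ControlCrop

variable (Q : ControlCrop.{u})

/-- The NOT gate on the first of `1 + n` wires. -/
def notHead (n : ℕ) : Q.Hom (1 + n) (1 + n) := Q.padRight n Q.x

theorem notHead_mul_self (n : ℕ) : Q.notHead n * Q.notHead n = 1 := by
  rw [notHead, ← map_mul, show Q.x * Q.x = 1 from Q.x_comp_x, map_one]

theorem notHead_mul_notHead_mul {n : ℕ} (f : Q.Hom (1 + n) (1 + n)) :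
    Q.notHead n * (Q.notHead n * f) = f := by
  rw [← mul_assoc, notHead_mul_self, one_mul]

theorem flip_mul_flip_mul {n : ℕ} (f : Q.Hom (1 + (1 + n)) (1 + (1 + n))) :
    Q.flip n * (Q.flip n * f) = f := by
  rw [← mul_assoc, Q.flip_mul_self, one_mul]

theorem ctrl_false {n : ℕ} (f : Q.Hom n n) :
    Q.ctrl false f = Q.notHead n * Q.ctrl true f * Q.notHead n := by
  have h : Q.notHead n * (Q.ctrl false f * Q.notHead n) = Q.ctrl true f := Q.colour f
  rw [← h, notHead_mul_notHead_mul, mul_assoc, notHead_mul_self, mul_one]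

/-- The operation `C¹` or `C⁰` as a monoid homomorphism. -/
def ctrlHom (b : Bool) {n : ℕ} : Q.Hom n n →* Q.Hom (1 + n) (1 + n) where
  toFun f := Q.ctrl b f
  map_one' := by
    cases b
    · rw [ctrl_false, show Q.ctrl true (1 : Q.Hom n n) = 1 from Q.ctrl_id n, mul_one,
        notHead_mul_self]
    · exact Q.ctrl_id n
  map_mul' f g := by
    have h : Q.ctrl true (f * g) = Q.ctrl true f * Q.ctrl true g := Q.ctrl_comp g f
    cases b
    · simp only [ctrl_false, h, mul_assoc, notHead_mul_notHead_mul]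
    · exact h

theorem ctrlHom_false {n : ℕ} (f : Q.Hom n n) :
    Q.ctrlHom false f = Q.notHead n * Q.ctrlHom true f * Q.notHead n := Q.ctrl_false f

theorem ctrlHom_commute {n : ℕ} (f g : Q.Hom n n) :
    Commute (Q.ctrlHom false f) (Q.ctrlHom true g) := Q.commutativity f g

theorem under_eq {n : ℕ} (f : Q.Hom n n) :
    Q.under f = Q.ctrlHom false f * Q.ctrlHom true f := (Q.complementarity f).symm

/-- Conjugation on the controlled wires. -/
theorem under_mul_ctrlHom (b : Bool) {n : ℕ} {f f' g : Q.Hom n n} (h : g * f = f' * g) :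
    Q.under g * Q.ctrlHom b f = Q.ctrlHom b f' * Q.under g := by
  cases b
  · rw [under_eq, (Q.ctrlHom_commute g g).eq, mul_assoc, ← map_mul, h, map_mul, ← mul_assoc,
      ← (Q.ctrlHom_commute _ _).eq, mul_assoc]
  · rw [under_eq, mul_assoc, ← map_mul, h, map_mul, ← mul_assoc, (Q.ctrlHom_commute _ _).eq,
      mul_assoc]

theorem castHom_padRight_ctrlHom {k : ℕ} (n : ℕ) (f : Q.Hom k k) :
    Q.castHom (Nat.add_assoc 1 k n) (Q.padRight n (Q.ctrlHom true f)) =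
      Q.ctrlHom true (Q.padRight n f) := by
  have h : Q.castHom (Nat.add_assoc 1 k n).symm (Q.ctrlHom true (Q.padRight n f)) =
    Q.padRight n (Q.ctrlHom true f) := Q.strength f n
  rw [← h, Q.castHom_castHom]
  rfl

theorem flip_mul_under_notHead (n : ℕ) :
    Q.flip n * Q.under (Q.notHead n) * Q.flip n = Q.notHead (1 + n) := Q.flip_mul_under n Q.x

theorem flip_mul_notHead (n : ℕ) :
    Q.flip n * Q.notHead (1 + n) = Q.under (Q.notHead n) * Q.flip n := by
  rw [← flip_mul_under_notHead, ← mul_assoc, ← mul_assoc, Q.flip_mul_self, one_mul]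

theorem notHead_mul_flip (n : ℕ) :
    Q.notHead (1 + n) * Q.flip n = Q.flip n * Q.under (Q.notHead n) := by
  rw [← flip_mul_under_notHead, mul_assoc, Q.flip_mul_self, mul_one]

/-- The symmetry of the first two wires is a product of three controlled NOT gates. -/
theorem swap_rule_flip (n : ℕ) :
    Q.ctrlHom true (Q.notHead n) * (Q.flip n * (Q.ctrlHom true (Q.notHead n) *
      (Q.flip n * Q.ctrlHom true (Q.notHead n)))) = Q.flip n := by
  rw [notHead, ← castHom_padRight_ctrlHom, PROP.flip]
  simp only [← map_mul]
  congr 2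
  exact Q.swap_rule

/-- Two controls on the first two wires are exchanged by the symmetry of these wires. -/
theorem flip_mul_ctrlHom_ctrlHom (b b' : Bool) {n : ℕ} (f : Q.Hom n n) :
    Q.flip n * Q.ctrlHom b (Q.ctrlHom b' f) = Q.ctrlHom b' (Q.ctrlHom b f) * Q.flip n := by
  have htt : Q.flip n * Q.ctrlHom true (Q.ctrlHom true f) =
    Q.ctrlHom true (Q.ctrlHom true f) * Q.flip n := Q.swap_coherence f
  have hx := (Q.notHead_mul_flip n).symm
  have hx' := Q.flip_mul_notHead n
  have hsq : Q.under (Q.notHead n) * Q.under (Q.notHead n) = 1 := by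
    rw [← map_mul, notHead_mul_self, map_one]
  have hin (b : Bool) : Q.ctrlHom b (Q.ctrlHom false f) =
      Q.under (Q.notHead n) * Q.ctrlHom b (Q.ctrlHom true f) * Q.under (Q.notHead n) := by
    rw [Q.under_mul_ctrlHom b (f' := Q.ctrlHom false f) (by
      rw [ctrlHom_false, mul_assoc, notHead_mul_self, mul_one]), mul_assoc, hsq, mul_one]
  have hft : Q.flip n * Q.ctrlHom false (Q.ctrlHom true f) =
      Q.ctrlHom true (Q.ctrlHom false f) * Q.flip n := by
    rw [ctrlHom_false, hin, ← mul_assoc, ← mul_assoc, hx', mul_assoc (Q.under _), htt, mul_assoc,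
      mul_assoc, hx', mul_assoc, mul_assoc]
  cases b <;> cases b'
  · rw [hin, ← mul_assoc, ← mul_assoc, hx, mul_assoc (Q.notHead _), hft, mul_assoc, mul_assoc, hx,
      ← mul_assoc, ← mul_assoc, ← ctrlHom_false, hin]
  · exact hft
  · rw [hin, ← mul_assoc, ← mul_assoc, hx, mul_assoc (Q.notHead _), htt, mul_assoc, mul_assoc, hx,
      ← mul_assoc, ← mul_assoc, ← ctrlHom_false]
  · exact htt

end ControlCrop

/-! ### Multiply controlled NOT gates -/

/-- The number `n`, as an iterated sum `1 + (1 + ⋯)`. Indexing by `stack n` makes the sources of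
iterated control operations agree definitionally. -/
def stack : ℕ → ℕ
  | 0 => 0
  | n + 1 => 1 + stack n

theorem stack_eq (n : ℕ) : stack n = n := by
  induction n with
  | zero => rfl
  | succ n ih => rw [stack, ih, Nat.add_comm]

namespace ControlCrop

variable (Q : ControlCrop.{u})

/-- The operation that controls on the second wire and leaves the first one in place. -/
def ctrlSnd (b : Bool) {n : ℕ} : Q.Hom (1 + n) (1 + n) →* Q.Hom (1 + (1 + n)) (1 + (1 + n)) where
  toFun f := Q.flip n * Q.ctrlHom b f * Q.flip n
  map_one' := by rw [map_one, mul_one, Q.flip_mul_self]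
  map_mul' f g := by simp only [map_mul, mul_assoc, flip_mul_flip_mul]

theorem ctrlSnd_apply (b : Bool) {n : ℕ} (f : Q.Hom (1 + n) (1 + n)) :
    Q.ctrlSnd b f = Q.flip n * Q.ctrlHom b f * Q.flip n := rfl

theorem ctrlSnd_commute {n : ℕ} (f g : Q.Hom (1 + n) (1 + n)) :
    Commute (Q.ctrlSnd false f) (Q.ctrlSnd true g) := by
  have h := (Q.ctrlHom_commute f g).eq
  simp only [Commute, SemiconjBy, ctrlSnd_apply, mul_assoc, flip_mul_flip_mul]
  rw [← mul_assoc (Q.ctrlHom false f), h, mul_assoc]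

theorem ctrlHom_ctrlHom (b b' : Bool) {n : ℕ} (f : Q.Hom n n) :
    Q.ctrlHom b (Q.ctrlHom b' f) = Q.ctrlSnd b' (Q.ctrlHom b f) := by
  rw [ctrlSnd_apply, flip_mul_ctrlHom_ctrlHom, mul_assoc, Q.flip_mul_self, mul_one]

theorem ctrlHom_conj (b : Bool) {n : ℕ} {s : Q.Hom n n} (hs : s * s = 1) (f : Q.Hom n n) :
    Q.ctrlHom b (s * f * s) = Q.under s * Q.ctrlHom b f * Q.under s := by
  rw [Q.under_mul_ctrlHom b (f' := s * f * s) (by rw [mul_assoc, hs, mul_one]),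
    mul_assoc (Q.ctrlHom b _), ← map_mul Q.under, hs, map_one, mul_one]

/-- A cyclic permutation of the first three wires turns a control on the third wire into a control
on the first one. -/
theorem ctrlHom_ctrlSnd (b b' : Bool) {n : ℕ} (f : Q.Hom (1 + n) (1 + n)) :
    Q.ctrlHom b (Q.ctrlSnd b' f) = Q.under (Q.flip n) * Q.flip (1 + n) *
      Q.ctrlHom b' (Q.ctrlHom b f) * (Q.flip (1 + n) * Q.under (Q.flip n)) := by
  rw [ctrlSnd_apply, ctrlHom_conj _ _ (Q.flip_mul_self n), ctrlHom_ctrlHom, ctrlSnd_apply]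
  simp only [mul_assoc]

/-- The counterpart of `ctrlHom_ctrlSnd` for two controls on the second and third wires. -/
theorem ctrlSnd_ctrlSnd (b b' : Bool) {n : ℕ} (f : Q.Hom (1 + n) (1 + n)) :
    Q.ctrlSnd b (Q.ctrlSnd b' f) = Q.under (Q.flip n) * Q.flip (1 + n) *
      Q.ctrlHom b' (Q.ctrlSnd b f) * (Q.flip (1 + n) * Q.under (Q.flip n)) := by
  have h := Q.flip_braid n
  rw [Q.ctrlSnd_apply b (Q.ctrlSnd b' f), ctrlHom_ctrlSnd, Q.ctrlSnd_apply b f,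
    ctrlHom_conj _ _ (Q.flip_mul_self n)]
  calc _ = Q.flip (1 + n) * Q.under (Q.flip n) * Q.flip (1 + n) * Q.ctrlHom b' (Q.ctrlHom b f) *
        (Q.flip (1 + n) * Q.under (Q.flip n) * Q.flip (1 + n)) := by simp only [mul_assoc]
    _ = _ := by
      rw [h]
      simp only [mul_assoc]

theorem flip_under_mul_flip_under {n : ℕ}
    (f : Q.Hom (1 + (1 + (1 + n))) (1 + (1 + (1 + n)))) :
    Q.flip (1 + n) * (Q.under (Q.flip n) * (Q.under (Q.flip n) * (Q.flip (1 + n) * f))) = f := by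
  rw [← mul_assoc (Q.under _), ← map_mul, Q.flip_mul_self, map_one, one_mul, flip_mul_flip_mul]

/-- The NOT gate on the first of `1 + n` wires, controlled positively on all the others. -/
def topGate : ∀ n : ℕ, Q.Hom (1 + stack n) (1 + stack n)
  | 0 => Q.x
  | n + 1 => Q.ctrlSnd true (topGate n)

theorem topGate_mul_self (n : ℕ) : Q.topGate n * Q.topGate n = 1 := by
  induction n with
  | zero => exact Q.x_comp_x
  | succ n ih =>
    change Q.ctrlSnd true (Q.topGate n) * Q.ctrlSnd true (Q.topGate n) = 1
    rw [← map_mul, ih]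
    exact map_one _

theorem notHead_zero : Q.notHead 0 = Q.x := Q.tensor_unit_right Q.x

/-- A multiply controlled NOT gate commutes with the NOT gate on its target. -/
theorem topGate_commute_notHead (n : ℕ) : Commute (Q.topGate n) (Q.notHead (stack n)) := by
  induction n with
  | zero =>
    change Q.x * Q.notHead 0 = Q.notHead 0 * Q.x
    rw [notHead_zero]
  | succ n ih =>
    have h := Q.under_mul_ctrlHom true ih.symm.eq
    change Q.ctrlSnd true (Q.topGate n) * Q.notHead (1 + stack n) =
      Q.notHead (1 + stack n) * Q.ctrlSnd true (Q.topGate n)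
    rw [← flip_mul_under_notHead, ctrlSnd_apply]
    simp only [mul_assoc, flip_mul_flip_mul]
    rw [← mul_assoc (Q.under _), h, mul_assoc]

/-- The case of a positive control in `topGate_braid`. The swap rule is the case of two wires, and a
cyclic permutation of the first three wires passes from each case to the next. -/
theorem topGate_braid_true (n : ℕ) :
    Q.ctrlHom true (Q.topGate n) * Q.ctrlSnd true (Q.topGate n) *
        Q.ctrlHom true (Q.topGate n) =
      Q.ctrlSnd true (Q.topGate n) * Q.ctrlHom true (Q.topGate n) *
        Q.ctrlSnd true (Q.topGate n) := by
  induction n with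
  | zero =>
    have h : Q.ctrlHom true Q.x * (Q.flip 0 * (Q.ctrlHom true Q.x * (Q.flip 0 *
      Q.ctrlHom true Q.x))) = Q.flip 0 := by
        have h := Q.swap_rule_flip 0
        rwa [notHead_zero] at h
    change Q.ctrlHom true Q.x * (Q.flip 0 * Q.ctrlHom true Q.x * Q.flip 0) * Q.ctrlHom true Q.x =
      (Q.flip 0 * Q.ctrlHom true Q.x * Q.flip 0) * Q.ctrlHom true Q.x *
        (Q.flip 0 * Q.ctrlHom true Q.x * Q.flip 0)
    generalize Q.ctrlHom true Q.x = a at *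
    calc a * (Q.flip 0 * a * Q.flip 0) * a = Q.flip 0 := by
          simpa only [mul_assoc] using h
      _ = Q.flip 0 * (a * (Q.flip 0 * (a * (Q.flip 0 * a)))) * Q.flip 0 := by
          rw [h, Q.flip_mul_self, one_mul]
      _ = _ := by simp only [mul_assoc]
  | succ n ih =>
    have ih' := congrArg (Q.ctrlHom true) ih
    simp only [map_mul, mul_assoc] at ih'
    change Q.ctrlHom true (Q.ctrlSnd true (Q.topGate n)) *
        Q.ctrlSnd true (Q.ctrlSnd true (Q.topGate n)) *
        Q.ctrlHom true (Q.ctrlSnd true (Q.topGate n)) =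
      Q.ctrlSnd true (Q.ctrlSnd true (Q.topGate n)) *
        Q.ctrlHom true (Q.ctrlSnd true (Q.topGate n)) *
        Q.ctrlSnd true (Q.ctrlSnd true (Q.topGate n))
    rw [ctrlHom_ctrlSnd, ctrlSnd_ctrlSnd]
    simp only [mul_assoc, flip_under_mul_flip_under]
    generalize Q.ctrlHom true (Q.ctrlHom true (Q.topGate n)) = p at *
    generalize Q.ctrlHom true (Q.ctrlSnd true (Q.topGate n)) = q at *
    have key (w) : p * (q * (p * w)) = q * (p * (q * w)) := by
      rw [← mul_assoc q, ← mul_assoc p, ih', mul_assoc, mul_assoc]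
    rw [key]

/-- The braid relation between multiply controlled NOT gates on the first two wires. -/
theorem topGate_braid (b : Bool) (n : ℕ) :
    Q.ctrlHom b (Q.topGate n) * Q.ctrlSnd true (Q.topGate n) * Q.ctrlHom b (Q.topGate n) =
      Q.ctrlSnd true (Q.topGate n) * Q.ctrlHom b (Q.topGate n) * Q.ctrlSnd true (Q.topGate n) := by
  cases b
  · have hx : Q.ctrlSnd true (Q.topGate n) * Q.notHead (1 + stack n) =
      Q.notHead (1 + stack n) * Q.ctrlSnd true (Q.topGate n) :=
        (Q.topGate_commute_notHead (n + 1)).eq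
    have h := Q.topGate_braid_true n
    have hsq (f : Q.Hom (1 + (1 + stack n)) (1 + (1 + stack n))) :
        Q.notHead (1 + stack n) * (Q.ctrlSnd true (Q.topGate n) * (Q.notHead (1 + stack n) * f)) =
          Q.ctrlSnd true (Q.topGate n) * f := by
      rw [← mul_assoc (Q.ctrlSnd true _), hx, mul_assoc, notHead_mul_notHead_mul]
    rw [ctrlHom_false]
    generalize Q.ctrlHom true (Q.topGate n) = c at *
    generalize Q.ctrlSnd true (Q.topGate n) = t at *
    generalize Q.notHead (1 + stack n) = x at *
    -- `C⁰` is the conjugate of `C¹` by `x`, and `x` commutes with `t`.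
    calc x * c * x * t * (x * c * x) = x * (c * (x * (t * (x * (c * x))))) := by
          simp only [mul_assoc]
      _ = x * (c * t * c) * x := by rw [hsq]; simp only [mul_assoc]
      _ = x * t * c * (t * x) := by rw [h]; simp only [mul_assoc]
      _ = x * t * c * (x * t) := by rw [hx]
      _ = t * x * c * (x * t) := by rw [hx]
      _ = t * (x * c * x) * t := by simp only [mul_assoc]
  · exact Q.topGate_braid_true n

/-- A multiply controlled NOT gate commutes with gates that are controlled on a common wire with
the opposite colour. -/
theorem commute_topGate_ctrlHom_ctrlHom_false (b : Bool) (n : ℕ)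
    (g : Q.Hom (stack n) (stack n)) :
    Commute (Q.ctrlHom b (Q.ctrlHom false g)) (Q.ctrlSnd true (Q.topGate n)) := by
  rw [ctrlHom_ctrlHom]
  exact Q.ctrlSnd_commute _ _

/-- Commutation with a multiply controlled NOT gate is inherited when both gates are controlled on a
further wire. -/
theorem commute_topGate_ctrlHom_ctrlHom_true (b : Bool) (n : ℕ) (g : Q.Hom (stack n) (stack n))
    (h : Commute (Q.ctrlHom b g) (Q.topGate n)) :
    Commute (Q.ctrlHom b (Q.ctrlHom true g)) (Q.ctrlSnd true (Q.topGate n)) := by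
  rw [ctrlHom_ctrlHom]
  exact h.map (Q.ctrlSnd true)

/-- The two gates are controlled on the third wire with opposite colours. -/
theorem commute_topGate_ctrlHom_ctrlSnd_false (b : Bool) (n : ℕ) :
    Commute (Q.ctrlHom b (Q.ctrlSnd false (Q.topGate n)))
      (Q.ctrlSnd true (Q.ctrlSnd true (Q.topGate n))) := by
  have h := (Q.ctrlHom_commute (Q.ctrlHom b (Q.topGate n)) (Q.ctrlSnd true (Q.topGate n))).eq
  rw [Commute, SemiconjBy]
  rw [ctrlHom_ctrlSnd, ctrlSnd_ctrlSnd]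
  simp only [mul_assoc, flip_under_mul_flip_under]
  rw [← mul_assoc (Q.ctrlHom false _), h, mul_assoc]

end ControlCrop

/-! ### Generation by controlled gates -/

/-- Induction along `n ↦ 1 + n`, the form of successor in the types of control operations. -/
@[elab_as_elim]
theorem one_add_induction {p : ℕ → Prop} (zero : p 0) (one_add : ∀ n, p n → p (1 + n)) (n : ℕ) :
    p n := by
  induction n with
  | zero => exact zero
  | succ n ih => exact Nat.add_comm 1 n ▸ one_add n ih

namespace PROP

variable (Q : PROP.{u})

theorem recast_id {m n : ℕ} (h : m = n) : recast (Q.id m) h h = Q.id n := by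
  subst h; rfl

/-- A left inverse of an invertible morphism is the inverse. -/
theorem eq_of_comp_eq_id {m n : ℕ} {f : Q.Hom m n} {g g' : Q.Hom n m} (h : Q.comp f g = Q.id m)
    (h' : Q.comp g' f = Q.id n) : g = g' := by
  rw [← Q.id_comp g, ← h', Q.comp_assoc, h, Q.comp_id]

theorem recast_tensor_id {m n m' n' : ℕ} (k : ℕ) (f : Q.Hom m n) (hm : m = m') (hn : n = n') :
    Q.tensor (recast f hm hn) (Q.id k) =
      recast (Q.tensor f (Q.id k)) (congrArg (· + k) hm) (congrArg (· + k) hn) := by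
  subst hm hn; rfl

/-- The symmetry with zero wires is the identity: by the hexagon law it is idempotent, and it is
invertible. -/
theorem swap_zero_right (l : ℕ) :
    recast (Q.swap l 0) (Nat.add_zero l) (Nat.zero_add l) = Q.id l := by
  have hex := Q.swap_hexagon l 0 0
  set e : Q.Hom l l := recast (Q.swap l 0) (Nat.add_zero l) (Nat.zero_add l) with he
  have hswap : Q.swap l 0 = recast e (Nat.add_zero l).symm (Nat.zero_add l).symm := by
    rw [he, recast_recast]; rfl
  have h₁ : recast (Q.tensor (Q.swap l 0) (Q.id 0)) rfl (Nat.add_assoc 0 l 0) =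
      recast (Q.tensor e (Q.id 0)) (by simp) (by simp) := by
    rw [hswap, recast_tensor_id, recast_recast]
  have h₂ : Q.tensor (Q.id 0) (Q.swap l 0) =
      recast (Q.tensor (Q.id 0) e) (by simp) (by simp) := by
    have (k k' : ℕ) (h : l = k) (h' : l = k') : Q.tensor (Q.id 0) (recast e h h') =
        recast (Q.tensor (Q.id 0) e) (congrArg (0 + ·) h) (congrArg (0 + ·) h') := by
      subst h h'; rfl
    rw [hswap, this]
  have h₃ : recast (Q.tensor e (Q.id 0)) (by simp) (by simp) =
      recast e (by simp : l = l + 0 + 0) (by simp : l = 0 + (l + 0)) := by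
    conv_rhs => rw [← Q.tensor_unit_right e, recast_recast]
  have h₄ : recast (Q.tensor (Q.id 0) e) (by simp) (by simp) =
      recast e (by simp : l = 0 + (l + 0)) (by simp : l = 0 + (0 + l)) := by
    conv_rhs => rw [← Q.tensor_unit_left e, recast_recast]
  rw [h₁, h₂, h₃, h₄, recast_comp] at hex
  have hee : e = Q.comp e e := by
    have h := congrArg (fun f => recast f (by simp : l + 0 + 0 = l) (by simp : 0 + (0 + l) = l)) hex
    simp only [recast_recast] at h
    exact h
  have hinv : Q.comp e (recast (Q.swap 0 l) (Nat.zero_add l) (Nat.add_zero l)) = Q.id l := by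
    rw [he, recast_comp, Q.swap_swap, recast_id]
  calc e = Q.comp e (Q.id l) := (Q.comp_id e).symm
    _ = Q.comp (Q.comp e e) (recast (Q.swap 0 l) (Nat.zero_add l) (Nat.add_zero l)) := by
      rw [← hinv, Q.comp_assoc, hinv, Q.comp_id]
    _ = Q.id l := by rw [← hee, hinv]

theorem swap_zero_left (l : ℕ) :
    recast (Q.swap 0 l) (Nat.zero_add l) (Nat.add_zero l) = Q.id l := by
  have hinv : Q.comp (recast (Q.swap l 0) (Nat.add_zero l) (Nat.zero_add l))
      (recast (Q.swap 0 l) (Nat.zero_add l) (Nat.add_zero l)) = Q.id l := by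
    rw [recast_comp, Q.swap_swap, recast_id]
  rwa [swap_zero_right, Q.id_comp] at hinv

/-- The second hexagon law, the inverse of the first one. -/
theorem swap_hexagon_inv (l m n : ℕ) :
    recast (Q.swap (l + m) n) (Nat.add_assoc l m n) (Nat.add_assoc n l m).symm =
      Q.comp (Q.tensor (Q.id l) (Q.swap m n))
        (recast (Q.tensor (Q.swap l n) (Q.id m)) (Nat.add_assoc l n m) rfl) := by
  refine Q.eq_of_comp_eq_id (f := recast (Q.swap n (l + m)) (Nat.add_assoc n l m).symm
    (Nat.add_assoc l m n)) ?_ ?_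
  · rw [recast_comp, Q.swap_swap, recast_id]
  · rw [Q.swap_hexagon, Q.comp_assoc, ← Q.comp_assoc (recast _ _ _), recast_comp, ← Q.tensor_comp,
      Q.swap_swap, Q.id_comp, Q.tensor_id, recast_id, Q.id_comp, ← Q.tensor_comp, Q.swap_swap,
      Q.id_comp, Q.tensor_id]

end PROP

namespace ControlCrop

variable (Q : ControlCrop.{u})

/-- The morphisms that are composites of controlled gates and of multiply controlled NOT gates on
the first wire. The clause `recast` makes the predicate independent of the way in which the source
and the target are written. -/
inductive Generated : ∀ {m n : ℕ}, Q.Hom m n → Prop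
  | id (n : ℕ) : Generated (Q.id n)
  | comp {l m n : ℕ} {f : Q.Hom l m} {g : Q.Hom m n} (hf : Generated f) (hg : Generated g) :
      Generated (Q.comp f g)
  | ctrl (b : Bool) {n : ℕ} (f : Q.Hom n n) : Generated (Q.ctrl b f)
  | topGate (n : ℕ) : Generated (Q.topGate n)
  | recast {m n m' n' : ℕ} {f : Q.Hom m n} (hf : Generated f) (hm : m = m') (hn : n = n') :
      Generated (recast f hm hn)

variable {Q}

namespace Generated

theorem of_recast {m n m' n' : ℕ} {f : Q.Hom m n} {hm : m = m'} {hn : n = n'}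
    (h : Q.Generated (_root_.recast f hm hn)) : Q.Generated f := by
  subst hm hn; exact h

theorem mul {n : ℕ} {f g : Q.Hom n n} (hf : Q.Generated f) (hg : Q.Generated g) :
    Q.Generated (f * g) := .comp hg hf

theorem under {n : ℕ} (f : Q.Hom n n) : Q.Generated (Q.under f) := by
  rw [under_eq]
  exact mul (.ctrl _ _) (.ctrl _ _)

theorem under_tensor {m n : ℕ} (f : Q.Hom m n) : Q.Generated (Q.tensor (Q.id 1) f) := by
  obtain rfl := Q.endo f
  exact under f

end Generated

variable (Q)

/-- The submonoid generated by the multiply controlled NOT gate on the first wire and the gates on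
the other wires. -/
def headGates (n : ℕ) : Submonoid (Q.Hom (1 + stack n) (1 + stack n)) :=
  Submonoid.closure ({Q.topGate n} ∪ Set.range Q.under)

theorem Generated.of_mem_headGates {n : ℕ} {f : Q.Hom (1 + stack n) (1 + stack n)}
    (hf : f ∈ Q.headGates n) : Q.Generated f := by
  induction hf using Submonoid.closure_induction with
  | mem f hf =>
    rcases hf with rfl | ⟨g, rfl⟩
    · exact .topGate n
    · exact .under g
  | one => exact .id _
  | mul f g _ _ hf hg => exact hf.mul hg

theorem under_mem_headGates {n : ℕ} (f : Q.Hom (stack n) (stack n)) :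
    Q.under f ∈ Q.headGates n := Submonoid.subset_closure (Or.inr ⟨f, rfl⟩)

/-- Control on the second wire commutes with adding a first wire, and it takes each multiply
controlled NOT gate to the next one. -/
theorem ctrlSnd_true_mem_headGates {n : ℕ} {f : Q.Hom (1 + stack n) (1 + stack n)}
    (hf : f ∈ Q.headGates n) : Q.ctrlSnd true f ∈ Q.headGates (n + 1) := by
  induction hf using Submonoid.closure_induction with
  | mem f hf =>
    rcases hf with rfl | ⟨g, rfl⟩
    · exact Submonoid.subset_closure (Or.inl rfl)
    · have h : Q.ctrlSnd true (Q.under g) = Q.under (Q.ctrlHom true g) := by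
        rw [under_eq, under_eq, map_mul, ctrlHom_ctrlHom, ctrlHom_ctrlHom]
      rw [h]
      exact Q.under_mem_headGates (n := n + 1) (Q.ctrlHom true g)
  | one =>
    rw [map_one]
    exact one_mem (Q.headGates (n + 1))
  | mul f g _ _ hf hg =>
    rw [map_mul]
    exact mul_mem (S := Submonoid (Q.Hom (1 + stack (n + 1)) (1 + stack (n + 1)))) hf hg

theorem ctrlSnd_false {n : ℕ} (f : Q.Hom (1 + n) (1 + n)) : Q.ctrlSnd false f =
    Q.under (Q.notHead n) * Q.ctrlSnd true f * Q.under (Q.notHead n) := by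
  rw [ctrlSnd_apply, ctrlSnd_apply, ctrlHom_false, ← mul_assoc, ← mul_assoc,
    flip_mul_notHead, mul_assoc _ _ (Q.flip n), notHead_mul_flip]
  simp only [mul_assoc]

/-- The NOT gate is the product of its two controlled versions with opposite colours. -/
theorem notHead_mem_headGates (n : ℕ) : Q.notHead (stack n) ∈ Q.headGates n := by
  induction n with
  | zero =>
    change Q.notHead 0 ∈ _
    rw [notHead_zero]
    exact Submonoid.subset_closure (Or.inl rfl)
  | succ n ih =>
    change Q.notHead (1 + stack n) ∈ _
    have h : Q.notHead (1 + stack n) = Q.ctrlSnd false (Q.notHead (stack n)) *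
        Q.ctrlSnd true (Q.notHead (stack n)) := by
      rw [← flip_mul_under_notHead, under_eq, ctrlSnd_apply, ctrlSnd_apply]
      simp only [mul_assoc, flip_mul_flip_mul]
    have hu : Q.under (Q.notHead (stack n)) ∈ Q.headGates (n + 1) :=
      Q.under_mem_headGates (n := n + 1) (Q.notHead (stack n))
    have ht := Q.ctrlSnd_true_mem_headGates ih
    rw [h, ctrlSnd_false]
    exact (Q.headGates (n + 1)).mul_mem ((Q.headGates (n + 1)).mul_mem
      ((Q.headGates (n + 1)).mul_mem hu ht) hu) ht

variable {Q}

namespace Generated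

theorem notHead (n : ℕ) : Q.Generated (Q.notHead n) := by
  have h := of_mem_headGates Q (Q.notHead_mem_headGates n)
  rwa [stack_eq] at h

theorem x : Q.Generated Q.x := by
  rw [← Q.notHead_zero]
  exact notHead 0

/-- By the swap rule, the symmetry of two wires is a product of controlled NOT gates. -/
theorem flip (n : ℕ) : Q.Generated (Q.flip n) := by
  have h : Q.Generated (Q.flip (stack n)) := by
    have hC : Q.Generated (Q.ctrlHom true (Q.notHead (stack n))) := .ctrl _ _
    have hK : Q.Generated (Q.ctrlSnd true (Q.notHead (stack n))) :=
      of_mem_headGates Q (n := n + 1)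
        (Q.ctrlSnd_true_mem_headGates (Q.notHead_mem_headGates n))
    rw [← swap_rule_flip, ← mul_assoc (Q.flip _), ← mul_assoc (Q.flip _ * _), ← ctrlSnd_apply]
    exact hC.mul (hK.mul hC)
  rwa [stack_eq] at h

theorem id_tensor (m : ℕ) {k n : ℕ} {f : Q.Hom k n} (hf : Q.Generated f) :
    Q.Generated (Q.tensor (Q.id m) f) := by
  induction m using one_add_induction with
  | zero =>
    rw [← Q.tensor_unit_left f] at hf
    exact hf.of_recast
  | one_add m ih =>
    rw [← Q.tensor_id]
    refine of_recast (hm := Nat.add_assoc 1 m k) (hn := Nat.add_assoc 1 m n) ?_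
    rw [Q.tensor_assoc]
    exact under_tensor _

theorem swap_one_tensor_id (m n : ℕ) : Q.Generated (Q.tensor (Q.swap 1 n) (Q.id m)) := by
  induction n using one_add_induction generalizing m with
  | zero =>
    rw [show Q.swap 1 0 = Q.id 1 from Q.swap_zero_right 1]
    exact under_tensor _
  | one_add n ih =>
    refine of_recast (hm := congrArg (· + m) (Nat.add_assoc 1 1 n).symm)
      (hn := congrArg (· + m) (Nat.add_assoc 1 n 1)) ?_
    rw [← Q.recast_tensor_id m (Q.swap 1 (1 + n)) (Nat.add_assoc 1 1 n).symm
      (Nat.add_assoc 1 n 1), Q.swap_hexagon, ← Q.id_comp (Q.id m), Q.tensor_comp,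
      Q.recast_tensor_id]
    refine .comp ?_ (of_recast (hm := Nat.add_assoc _ _ _) (hn := Nat.add_assoc _ _ _) ?_)
    · refine .recast (of_recast (hm := Nat.add_assoc _ _ _) (hn := Nat.add_assoc _ _ _) ?_) _ _
      rw [Q.tensor_assoc, Q.tensor_id]
      exact of_recast (flip (n + m))
    · rw [Q.tensor_assoc]
      exact under_tensor _

theorem swap (m n : ℕ) : Q.Generated (Q.swap m n) := by
  induction m using one_add_induction with
  | zero =>
    refine of_recast (hm := Nat.zero_add n) (hn := Nat.add_zero n) ?_
    rw [Q.swap_zero_left]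
    exact .id n
  | one_add m ih =>
    refine of_recast (hm := Nat.add_assoc 1 m n) (hn := (Nat.add_assoc n 1 m).symm) ?_
    rw [Q.swap_hexagon_inv]
    exact .comp (under_tensor _) (.recast (swap_one_tensor_id m n) _ _)

theorem tensor {m n m' n' : ℕ} {f : Q.Hom m n} {g : Q.Hom m' n'} (hf : Q.Generated f)
    (hg : Q.Generated g) : Q.Generated (Q.tensor f g) := by
  have h₁ : Q.Generated (Q.tensor f (Q.id m')) := by
    have h : Q.tensor f (Q.id m') =
        Q.comp (Q.comp (Q.swap m m') (Q.tensor (Q.id m') f)) (Q.swap m' n) := by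
      rw [← Q.swap_natural, Q.comp_assoc, Q.swap_swap, Q.comp_id]
    rw [h]
    exact .comp (.comp (swap m m') (id_tensor m' hf)) (swap m' n)
  have h₂ : Q.tensor f g = Q.comp (Q.tensor f (Q.id m')) (Q.tensor (Q.id n) g) := by
    rw [← Q.tensor_comp, Q.comp_id, Q.id_comp]
  rw [h₂]
  exact .comp h₁ (id_tensor n hg)

/-- The only morphism on zero wires is the identity. -/
theorem recast_eq_id {m n : ℕ} {f : Q.Hom m n}
    (hf : Q.Generated f) (hm : m = 0) (hn : n = 0) :
    _root_.recast f hm hn = Q.id 0 := by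
  induction hf with
  | id n => subst hm; rfl
  | @comp l m n f g _ _ ihf ihg =>
    obtain rfl := Q.endo f
    rw [← Q.recast_comp f g hm hm hn, ihf hm hm, ihg hm hn, Q.id_comp]
  | ctrl b f => omega
  | topGate n => omega
  | recast _ hm' hn' ih =>
    rw [recast_recast]
    exact ih _ _

/-- On `1 + k` wires, the generating morphisms are the gates controlled by the first wire and the
multiply controlled NOT gate on it. -/
theorem recast_mem_closure {m n : ℕ} {f : Q.Hom m n}
    (hf : Q.Generated f) (k : ℕ) (hm : m = 1 + stack k) (hn : n = 1 + stack k) :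
    _root_.recast f hm hn ∈ Submonoid.closure (Set.range (Q.ctrlHom false (n := stack k)) ∪
      Set.range (Q.ctrlHom true (n := stack k)) ∪ {Q.topGate k}) := by
  induction hf with
  | id n => subst hm; exact one_mem _
  | @comp l m n f g _ _ ihf ihg =>
    obtain rfl := Q.endo f
    rw [← Q.recast_comp f g hm hm hn]
    exact mul_mem (ihg hm hn) (ihf hm hm)
  | @ctrl b n f =>
    obtain rfl : n = stack k := by omega
    refine Submonoid.subset_closure (Or.inl ?_)
    cases b
    · exact Or.inl ⟨f, rfl⟩
    · exact Or.inr ⟨f, rfl⟩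
  | topGate j =>
    obtain rfl : j = k := by
      rw [stack_eq, stack_eq] at hm
      omega
    exact Submonoid.subset_closure (Or.inr rfl)
  | recast _ hm' hn' ih =>
    rw [recast_recast]
    exact ih _ _

end Generated

end ControlCrop

/-! ### Universal properties of presented props -/

section Eval

variable {G : ℕ → ℕ → Type u} {K : Type} (Q : PROP.{u}) (g : ∀ m n : ℕ, G m n → Q.Hom m n)
  (c : K → ∀ n : ℕ, Q.Hom n n → Q.Hom (1 + n) (1 + n))

/-- The value of a formal expression in a prop, for given values `g` of the generators and given
operations `c`. -/
def Expr.eval {m n : ℕ} : Expr G K m n → Q.Hom m n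
  | .gen f => g _ _ f
  | .id n => Q.id n
  | .comp e₁ e₂ => Q.comp e₁.eval e₂.eval
  | .tensor e₁ e₂ => Q.tensor e₁.eval e₂.eval
  | .swap m n => Q.swap m n
  | .ctrl b e => c b _ e.eval

theorem Expr.eval_recast {m n m' n' : ℕ} (e : Expr G K m n) (hm : m = m') (hn : n = n') :
    (recast e hm hn).eval Q g c = recast (e.eval Q g c) hm hn := by
  subst hm hn; rfl

/-- Evaluation respects the congruence generated by `R` if it respects `R`. -/
theorem Conv.eval_eq {R : ∀ m n : ℕ, Expr G K m n → Expr G K m n → Prop}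
    (hR : ∀ m n (e e' : Expr G K m n), R m n e e' → e.eval Q g c = e'.eval Q g c) {m n : ℕ}
    {e e' : Expr G K m n} (h : Conv R m n e e') : e.eval Q g c = e'.eval Q g c := by
  induction h with
  | rel h => exact hR _ _ _ _ h
  | refl => rfl
  | symm _ ih => exact ih.symm
  | trans _ _ ih₁ ih₂ => exact ih₁.trans ih₂
  | comp_congr _ _ ih₁ ih₂ => simp only [Expr.eval, ih₁, ih₂]
  | tensor_congr _ _ ih₁ ih₂ => simp only [Expr.eval, ih₁, ih₂]
  | ctrl_congr _ _ ih => simp only [Expr.eval, ih]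
  | id_comp f => exact Q.id_comp _
  | comp_id f => exact Q.comp_id _
  | comp_assoc f g h => exact Q.comp_assoc _ _ _
  | tensor_id m n => exact Q.tensor_id m n
  | tensor_comp f g f' g' => exact Q.tensor_comp _ _ _ _
  | tensor_assoc f g h => rw [Expr.eval_recast]; exact Q.tensor_assoc _ _ _
  | tensor_unit_left f => rw [Expr.eval_recast]; exact Q.tensor_unit_left _
  | tensor_unit_right f => rw [Expr.eval_recast]; exact Q.tensor_unit_right _
  | swap_natural f g => exact Q.swap_natural _ _
  | swap_swap m n => exact Q.swap_swap m n
  | swap_hexagon l m n =>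
    rw [Expr.eval_recast, Expr.eval, Expr.eval_recast]
    exact Q.swap_hexagon l m n

end Eval

/-- The value of the generator of `cropX` in a crop. -/
def NotGen.value (Q : Crop.{0}) : ∀ m n : ℕ, NotGen m n → Q.Hom m n
  | _, _, .x => Q.x

/-- The crop morphism out of the crop generated by an involution. -/
def cropXLift (Q : Crop.{0}) : CropHom cropX Q where
  map := Quot.lift (Expr.eval Q.toPROP (NotGen.value Q) (fun b => b.elim))
    fun _ _ h => h.eval_eq _ _ _ (by
      rintro _ _ _ _ ⟨⟩
      exact Q.x_comp_x)
  map_id _ := rfl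
  map_comp := by rintro l m n ⟨f⟩ ⟨g⟩; rfl
  map_tensor := by rintro m n m' n' ⟨f⟩ ⟨g⟩; rfl
  map_swap _ _ := rfl
  map_x := rfl

/-- The crop morphism out of a controlled prop that extends a given crop morphism and sends the
adjoined control operations to those of `Q`. -/
def controlledLift {P : Crop.{u}} (Q : ControlCrop.{u}) (h : CropHom P Q.toCrop) :
    CropHom (controlled P) Q.toCrop where
  map := Quot.lift (Expr.eval Q.toPROP (fun _ _ f => h.map f) (fun b _ f => Q.ctrl b f))
    fun _ _ h' => h'.eval_eq _ _ _ (by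
      intro _ _ _ _ r
      cases r with
      | gen_id => exact h.map_id _
      | gen_comp f g => exact h.map_comp f g
      | gen_tensor f g => exact h.map_tensor f g
      | gen_swap => exact h.map_swap _ _
      | composition f g => exact Q.ctrl_comp _ _
      | identity => exact Q.ctrl_id _
      | strength f m => rw [Expr.eval_recast]; exact Q.strength _ m
      | colour f => simp only [Expr.eval, h.map_x]; exact Q.colour _
      | complementarity f => exact Q.complementarity _
      | commutativity f₁ f₂ => exact Q.commutativity _ _
      | swap_rule => simp only [Expr.eval, h.map_x]; exact Q.swap_rule
      | swap_coherence f =>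
        simp only [Expr.eval, Expr.eval_recast]
        exact Q.swap_coherence _)
  map_id _ := rfl
  map_comp := by rintro l m n ⟨f⟩ ⟨g⟩; rfl
  map_tensor := by rintro m n m' n' ⟨f⟩ ⟨g⟩; rfl
  map_swap _ _ := rfl
  map_x := h.map_x

/-- The controlled prop of a crop, with its control operations. -/
def controlledCrop (P : Crop.{u}) : ControlCrop.{u} where
  toCrop := controlled P
  ctrl b := Quot.map (Expr.ctrl b) fun _ _ h => .ctrl_congr b h
  ctrl_comp := by rintro n ⟨f⟩ ⟨g⟩; exact Quot.sound (.rel (.composition f g))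
  ctrl_id n := Quot.sound (.rel (.identity n))
  strength := by
    rintro n ⟨f⟩ m
    exact (recast_quot_mk _ _ _ _).trans (Quot.sound (.rel (.strength f m)))
  colour := by rintro n ⟨f⟩; exact Quot.sound (.rel (.colour f))
  complementarity := by rintro n ⟨f⟩; exact Quot.sound (.rel (.complementarity f))
  commutativity := by rintro n ⟨f⟩ ⟨g⟩; exact Quot.sound (.rel (.commutativity f g))
  swap_rule := Quot.sound (.rel .swap_rule)
  swap_coherence := by
    rintro n ⟨f⟩
    have h : (recast ((controlled P).tensor ((controlled P).swap 1 1) ((controlled P).id n))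
        (Nat.add_assoc 1 1 n) (Nat.add_assoc 1 1 n)) = Quot.mk _
          (recast (.tensor (.swap 1 1) (.id n)) (Nat.add_assoc 1 1 n) (Nat.add_assoc 1 1 n)) :=
      recast_quot_mk (ControlRel P) (.tensor (.swap 1 1) (.id n)) (Nat.add_assoc 1 1 n)
        (Nat.add_assoc 1 1 n)
    rw [h]
    exact Quot.sound (.rel (.swap_coherence f))

theorem controlledLift_ctrl {P : Crop.{u}} (Q : ControlCrop.{u}) (h : CropHom P Q.toCrop)
    (b : Bool) {n : ℕ} (f : (controlledCrop P).Hom n n) :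
    (controlledLift Q h).map ((controlledCrop P).ctrl b f) =
      Q.ctrl b ((controlledLift Q h).map f) := by
  obtain ⟨f⟩ := f; rfl

/-- Every morphism of the controlled prop of `cropX` is built from the NOT gate by the operations
of a prop and by control. -/
theorem controlledCrop_cropX_induction
    {p : ∀ m n : ℕ, (controlledCrop cropX).Hom m n → Prop}
    (id : ∀ n, p n n ((controlledCrop cropX).id n))
    (comp : ∀ l m n f g, p l m f → p m n g → p l n ((controlledCrop cropX).comp f g))
    (tensor : ∀ m n m' n' f g, p m n f → p m' n' g →
      p (m + m') (n + n') ((controlledCrop cropX).tensor f g))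
    (swap : ∀ m n, p (m + n) (n + m) ((controlledCrop cropX).swap m n))
    (ctrl : ∀ b n f, p n n f → p (1 + n) (1 + n) ((controlledCrop cropX).ctrl b f))
    (x : p 1 1 (controlledCrop cropX).x) {m n : ℕ} (f : (controlledCrop cropX).Hom m n) :
    p m n f := by
  refine Quot.ind (fun e => ?_) f
  clear f
  induction e with
  | gen g =>
    refine Quot.ind (β := fun g => p _ _ (Quot.mk _ (.gen g))) (fun e => ?_) g
    clear g
    induction e with
    | gen g => cases g; exact x
    | id n =>
      have h : Quot.mk _ (.gen (cropX.id n)) = (controlledCrop cropX).id n :=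
        Quot.sound (.rel (.gen_id n))
      exact h ▸ id n
    | comp f g hf hg =>
      have h : Quot.mk _ (.gen (cropX.comp (Quot.mk _ f) (Quot.mk _ g))) =
          (controlledCrop cropX).comp (Quot.mk _ (.gen (Quot.mk _ f)))
            (Quot.mk _ (.gen (Quot.mk _ g))) :=
        Quot.sound (.rel (.gen_comp (P := cropX) (Quot.mk _ f) (Quot.mk _ g)))
      exact h ▸ comp _ _ _ _ _ hf hg
    | tensor f g hf hg =>
      have h : Quot.mk _ (.gen (cropX.tensor (Quot.mk _ f) (Quot.mk _ g))) =
          (controlledCrop cropX).tensor (Quot.mk _ (.gen (Quot.mk _ f)))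
            (Quot.mk _ (.gen (Quot.mk _ g))) :=
        Quot.sound (.rel (.gen_tensor (P := cropX) (Quot.mk _ f) (Quot.mk _ g)))
      exact h ▸ tensor _ _ _ _ _ _ hf hg
    | swap m n =>
      have h : Quot.mk _ (.gen (cropX.swap m n)) = (controlledCrop cropX).swap m n :=
        Quot.sound (.rel (.gen_swap m n))
      exact h ▸ swap m n
    | ctrl b => exact b.elim
  | id n => exact id n
  | comp f g hf hg => exact comp _ _ _ _ _ hf hg
  | tensor f g hf hg => exact tensor _ _ _ _ _ _ hf hg
  | swap m n => exact swap m n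
  | ctrl b f hf => exact ctrl b _ _ hf

/-- The crop `cX`, with its control operations. -/
abbrev cX : ControlCrop.{0} := controlledCrop cropX

/-- Every morphism of `cX` is a composite of gates controlled by the first wire and of multiply
controlled NOT gates on it. -/
theorem generated_cropX {m n : ℕ} (f : (controlledCrop cropX).Hom m n) :
    (controlledCrop cropX).Generated f :=
  controlledCrop_cropX_induction (p := fun _ _ f => (controlledCrop cropX).Generated f)
    (fun n => .id n) (fun _ _ _ _ _ => .comp) (fun _ _ _ _ _ _ => .tensor)
    (fun m n => .swap m n) (fun b _ f _ => .ctrl b f) .x f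

/-! ### Controlled permutations -/

/-- The bits, as the elements of `[2]`. -/
def bit (b : Bool) : Fin (2 ^ 1) := finTwoEquiv.symm b

/-- The element of `[2 ^ (1 + n)]` with a given first bit. -/
def bitPair (n : ℕ) : Bool × Fin (2 ^ n) ≃ Fin (2 ^ (1 + n)) :=
  ((finTwoEquiv.symm.prodCongr (Equiv.refl (Fin (2 ^ n)))).trans finProdFinEquiv).trans
    (finCongr (Nat.pow_add 2 1 n).symm)

theorem bitPair_apply {n : ℕ} (b : Bool) (r : Fin (2 ^ n)) :
    bitPair n (b, r) = perm2Pair (bit b) r := rfl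

/-- A permutation controlled by the first bit. -/
def ctrlPerm (b : Bool) {n : ℕ} (f : PermHom (2 ^ n) (2 ^ n)) :
    PermHom (2 ^ (1 + n)) (2 ^ (1 + n)) :=
  (bitPair n).permCongr (Equiv.Perm.prodExtendRight b f)

theorem ctrlPerm_pair (b b' : Bool) {n : ℕ} (f : PermHom (2 ^ n) (2 ^ n)) (r : Fin (2 ^ n)) :
    ctrlPerm b f (perm2Pair (bit b') r) = perm2Pair (bit b') (if b' = b then f r else r) := by
  rw [← bitPair_apply, ctrlPerm, Equiv.permCongr_apply, Equiv.symm_apply_apply]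
  split_ifs with h
  · subst h; rw [Equiv.Perm.prodExtendRight_apply_eq]; rfl
  · rw [Equiv.Perm.prodExtendRight_apply_ne _ h]; rfl

theorem bit_surj (a : Fin (2 ^ 1)) : ∃ b, a = bit b :=
  ⟨finTwoEquiv a, (finTwoEquiv.symm_apply_apply a).symm⟩

theorem permSumSymm_bit (b : Bool) :
    (permSumSymm 1 1 : PermHom (2 ^ 1) (2 ^ 1)) (bit b) = bit (!b) := by
  cases b <;> rfl

/-- Permutations of `[2 ^ (1 + n)]` agree if they agree on all pairs. -/
theorem permHom_ext_pair {n k : ℕ} {f g : PermHom (2 ^ (1 + n)) k}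
    (h : ∀ b r, f (perm2Pair (bit b) r) = g (perm2Pair (bit b) r)) : f = g := by
  refine Equiv.ext fun i => ?_
  obtain ⟨a, r, rfl⟩ := perm2Pair_surj i
  obtain ⟨b, rfl⟩ := bit_surj a
  exact h b r

section CtrlPerm

variable {n : ℕ} (f g : PermHom (2 ^ n) (2 ^ n))

theorem ctrlPerm_trans (b : Bool) :
    ctrlPerm b (f.trans g) = (ctrlPerm b f).trans (ctrlPerm b g) := by
  refine permHom_ext_pair fun b' r => ?_
  by_cases h : b' = b <;> simp [ctrlPerm_pair, h]

theorem ctrlPerm_refl (b : Bool) : ctrlPerm b (Equiv.refl (Fin (2 ^ n))) = Equiv.refl _ := by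
  refine permHom_ext_pair fun b' r => ?_
  simp [ctrlPerm_pair]

theorem ctrlPerm_strength (m : ℕ) :
    (recast (F := fun m n => PermHom (2 ^ m) (2 ^ n))
      (ctrlPerm true (perm2Tensor f (Equiv.refl (Fin (2 ^ m))))) (Nat.add_assoc 1 n m).symm
      (Nat.add_assoc 1 n m).symm : PermHom (2 ^ (1 + n + m)) (2 ^ (1 + n + m))) =
      perm2Tensor (ctrlPerm true f) (Equiv.refl _) := by
  refine Equiv.ext fun i => ?_
  obtain ⟨i, c, rfl⟩ := perm2Pair_surj i
  obtain ⟨a, r, rfl⟩ := perm2Pair_surj i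
  obtain ⟨b, rfl⟩ := bit_surj a
  rw [recast_permHom_pow_apply, perm2Pair_assoc, ctrlPerm_pair, perm2Tensor_pair,
    perm2Tensor_pair, ctrlPerm_pair]
  cases b <;> simp [perm2Pair_assoc_symm]

theorem ctrlPerm_colour :
    ((perm2Tensor (permSumSymm 1 1 : PermHom (2 ^ 1) (2 ^ 1)) (Equiv.refl _)).trans
      (ctrlPerm false f)).trans (perm2Tensor (permSumSymm 1 1 : PermHom (2 ^ 1) (2 ^ 1))
        (Equiv.refl _)) = ctrlPerm true f := by
  refine permHom_ext_pair fun b r => ?_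
  rw [Equiv.trans_apply, Equiv.trans_apply, perm2Tensor_pair, permSumSymm_bit, ctrlPerm_pair,
    perm2Tensor_pair, permSumSymm_bit, ctrlPerm_pair]
  cases b <;> simp

theorem ctrlPerm_complementarity : (ctrlPerm true f).trans (ctrlPerm false f) =
    perm2Tensor (Equiv.refl (Fin (2 ^ 1))) f := by
  refine permHom_ext_pair fun b r => ?_
  rw [Equiv.trans_apply, perm2Tensor_pair, ctrlPerm_pair, ctrlPerm_pair]
  cases b <;> simp

theorem ctrlPerm_comm : (ctrlPerm true g).trans (ctrlPerm false f) =
    (ctrlPerm false f).trans (ctrlPerm true g) := by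
  refine permHom_ext_pair fun b r => ?_
  rw [Equiv.trans_apply, Equiv.trans_apply, ctrlPerm_pair, ctrlPerm_pair, ctrlPerm_pair,
    ctrlPerm_pair]
  cases b <;> simp

theorem ctrlPerm_swap_rule :
    (((((ctrlPerm true (permSumSymm 1 1 : PermHom (2 ^ 1) (2 ^ 1))).trans (perm2Swap 1 1)).trans
      (ctrlPerm true (permSumSymm 1 1 : PermHom (2 ^ 1) (2 ^ 1)))).trans (perm2Swap 1 1)).trans
      (ctrlPerm true (permSumSymm 1 1 : PermHom (2 ^ 1) (2 ^ 1)))) = perm2Swap 1 1 := by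
  refine permHom_ext_pair fun b r => ?_
  obtain ⟨b', rfl⟩ := bit_surj r
  simp only [Equiv.trans_apply, ctrlPerm_pair, permSumSymm_bit]
  cases b <;> cases b' <;> simp only [perm2Swap_pair, ctrlPerm_pair, permSumSymm_bit, if_true,
    if_false, Bool.false_eq_true, Bool.not_true, Bool.not_false]

/-- The symmetry of the first two bits. -/
def perm2Flip (n : ℕ) : PermHom (2 ^ (1 + (1 + n))) (2 ^ (1 + (1 + n))) :=
  recast (F := fun m n => PermHom (2 ^ m) (2 ^ n))
    (perm2Tensor (perm2Swap 1 1) (Equiv.refl (Fin (2 ^ n)))) (Nat.add_assoc 1 1 n)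
    (Nat.add_assoc 1 1 n)

theorem perm2Flip_pair (b b' : Bool) (r : Fin (2 ^ n)) :
    perm2Flip n (perm2Pair (bit b) (perm2Pair (bit b') r)) =
      perm2Pair (bit b') (perm2Pair (bit b) r) := by
  rw [perm2Flip, recast_permHom_pow_apply, perm2Pair_assoc_symm, perm2Tensor_pair,
    perm2Swap_pair, perm2Pair_assoc]
  rfl

theorem ctrlPerm_ctrlPerm_flip : (ctrlPerm true (ctrlPerm true f)).trans (perm2Flip n) =
    (perm2Flip n).trans (ctrlPerm true (ctrlPerm true f)) := by
  refine permHom_ext_pair fun b r => ?_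
  obtain ⟨a, r, rfl⟩ := perm2Pair_surj r
  obtain ⟨b', rfl⟩ := bit_surj a
  rw [Equiv.trans_apply, Equiv.trans_apply, perm2Flip_pair, ctrlPerm_pair, ctrlPerm_pair,
    ctrlPerm_pair, ctrlPerm_pair]
  cases b <;> cases b' <;> simp [perm2Flip_pair]

end CtrlPerm

theorem perm2_swap_rule :
    perm2.comp (perm2.comp (perm2.comp (perm2.comp (ctrlPerm true perm2.x) (perm2.swap 1 1))
      (ctrlPerm true perm2.x)) (perm2.swap 1 1)) (ctrlPerm true perm2.x) = perm2.swap 1 1 := by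
  -- Unfolding first keeps the unifier from evaluating the concrete permutations of `[4]`.
  delta perm2
  dsimp only
  exact ctrlPerm_swap_rule

/-- The crop `Perm₂` with its control operations. -/
def perm2Ctrl : ControlCrop.{0} where
  toCrop := perm2
  ctrl b := ctrlPerm b
  ctrl_comp f g := ctrlPerm_trans f g true
  ctrl_id _ := ctrlPerm_refl true
  strength f m := ctrlPerm_strength f m
  colour f := ctrlPerm_colour f
  complementarity f := ctrlPerm_complementarity f
  commutativity f g := ctrlPerm_comm f g
  swap_rule := perm2_swap_rule
  swap_coherence f := ctrlPerm_ctrlPerm_flip f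

/-! ### The interpretation by permutations -/

section Interpretation

open Equiv Equiv.Perm ControlCrop

/-- The interpretation of `cX` by permutations. -/
def interp : CropHom (controlled cropX) perm2 := controlledLift perm2Ctrl (cropXLift perm2)

theorem CropHom.map_recast {P Q : Crop.{0}} (h : CropHom P Q) {m n m' n' : ℕ} (f : P.Hom m n)
    (hm : m = m') (hn : n = n') : h.map (recast f hm hn) = recast (h.map f) hm hn := by
  subst hm hn; rfl

/-- The interpretation of endomorphisms, as a monoid homomorphism. -/
def interpHom (n : ℕ) : cX.Hom n n →* Perm (Fin (2 ^ n)) where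
  toFun f := interp.map f
  map_one' := interp.map_id n
  map_mul' f g := interp.map_comp g f

theorem interpHom_ctrlHom (b : Bool) {n : ℕ} (f : cX.Hom n n) :
    interpHom (1 + n) (cX.ctrlHom b f) = ctrlPerm b (interpHom n f) :=
  controlledLift_ctrl perm2Ctrl (cropXLift perm2) b f

theorem interpHom_flip (n : ℕ) : interpHom (1 + (1 + n)) (cX.flip n) = perm2Flip n := by
  refine (interp.map_recast _ _ _).trans ?_
  have h : interp.map ((controlled cropX).tensor ((controlled cropX).swap 1 1)
      ((controlled cropX).id n)) = perm2Tensor (perm2Swap 1 1) (Equiv.refl (Fin (2 ^ n))) := by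
    rw [interp.map_tensor, interp.map_swap, interp.map_id]
    rfl
  exact congrArg (fun f => recast (F := fun m n => PermHom (2 ^ m) (2 ^ n)) f
    (Nat.add_assoc 1 1 n) (Nat.add_assoc 1 1 n)) h

/-- The string of `n` bits `true`. -/
def topPoint : ∀ n : ℕ, Fin (2 ^ stack n)
  | 0 => 0
  | n + 1 => perm2Pair (bit true) (topPoint n)

theorem ctrlPerm_swap (b : Bool) {n : ℕ} (x y : Fin (2 ^ n)) :
    ctrlPerm b (swap x y) = swap (perm2Pair (bit b) x) (perm2Pair (bit b) y) := by
  rw [ctrlPerm, prodExtendRight_swap]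
  exact symm_trans_swap_trans _ _ _

theorem interpHom_ctrlSnd (b : Bool) {n : ℕ} (f : cX.Hom (1 + n) (1 + n)) (r : Fin (2 ^ n))
    (hf : interpHom (1 + n) f = swap (perm2Pair (bit false) r) (perm2Pair (bit true) r)) :
    interpHom (1 + (1 + n)) (cX.ctrlSnd b f) =
      swap (perm2Pair (bit false) (perm2Pair (bit b) r))
        (perm2Pair (bit true) (perm2Pair (bit b) r)) := by
  have hinv : perm2Flip n = (perm2Flip n)⁻¹ := by
    rw [← interpHom_flip, eq_inv_iff_mul_eq_one, ← map_mul, PROP.flip_mul_self, map_one]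
  rw [ctrlSnd_apply, map_mul, map_mul, interpHom_ctrlHom, hf, ctrlPerm_swap, interpHom_flip]
  nth_rw 2 [hinv]
  rw [← swap_apply_apply, perm2Flip_pair, perm2Flip_pair]

/-- A multiply controlled NOT gate is interpreted by a transposition. -/
theorem interpHom_topGate (n : ℕ) : interpHom (1 + stack n) (cX.topGate n) =
    swap (perm2Pair (bit false) (topPoint n)) (perm2Pair (bit true) (topPoint n)) := by
  induction n with
  | zero =>
    have h : interpHom 1 cX.x = permSumSymm 1 1 := interp.map_x
    refine h.trans (Equiv.ext fun i => ?_)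
    revert i
    decide
  | succ n ih => exact interpHom_ctrlSnd true (cX.topGate n) (topPoint n) ih

theorem perm2Pair_bit_injective {n : ℕ} {b b' : Bool} {r r' : Fin (2 ^ n)}
    (h : perm2Pair (bit b) r = perm2Pair (bit b') r') : b = b' ∧ r = r' := by
  rw [← bitPair_apply, ← bitPair_apply, EmbeddingLike.apply_eq_iff_eq, Prod.mk.injEq] at h
  exact h

theorem topPoint_zero_unique (r : Fin (2 ^ stack 0)) : r = topPoint 0 :=
  Subsingleton.elim (α := Fin 1) _ _

/-- The interpretation of endomorphisms of `1 + n`, as permutations of pairs of a bit and a string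
of bits. -/
def interpPairHom (n : ℕ) : cX.Hom (1 + n) (1 + n) →* Perm (Bool × Fin (2 ^ n)) :=
  (bitPair n).symm.permCongrHom.toMonoidHom.comp (interpHom (1 + n))

theorem interpPairHom_apply (n : ℕ) (f : cX.Hom (1 + n) (1 + n)) :
    interpPairHom n f = (bitPair n).symm.permCongr (interpHom (1 + n) f) := rfl

theorem interpPairHom_ctrlHom (b : Bool) {n : ℕ} (f : cX.Hom n n) :
    interpPairHom n (cX.ctrlHom b f) = prodExtendRight b (interpHom n f) := by
  rw [interpPairHom_apply, interpHom_ctrlHom]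
  exact (bitPair n).permCongr.symm_apply_apply _

theorem interpPairHom_eq_swap {n : ℕ} {f : cX.Hom (1 + n) (1 + n)} {r : Fin (2 ^ n)}
    (hf : interpHom (1 + n) f = swap (perm2Pair (bit false) r) (perm2Pair (bit true) r)) :
    interpPairHom n f = swap (false, r) (true, r) := by
  rw [interpPairHom_apply, hf, ← bitPair_apply, ← bitPair_apply]
  exact (symm_trans_swap_trans _ _ _).trans (by simp)

theorem bijective_interpPairHom_iff (n : ℕ) :
    Function.Bijective (interpPairHom n) ↔ Function.Bijective (interpHom (1 + n)) :=
  ((bitPair n).symm.permCongrHom.toEquiv.comp_bijective _)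

/-- If the interpretation is bijective on `n` wires, then the gates controlled by the first of
`1 + n` wires form two copies of a symmetric group, and the multiply controlled NOT gate on the
first wire satisfies the relations of `bijective_of_generated`. -/
theorem bijective_interpHom_succ (n : ℕ) (hbij : Function.Bijective (interpHom (stack n)))
    (hstab : ∀ b g, interpHom (stack n) g (topPoint n) = topPoint n →
      Commute (cX.ctrlHom b g) (cX.topGate n)) :
    Function.Bijective (interpHom (1 + stack n)) := by
  rw [← bijective_interpPairHom_iff]
  refine bijective_of_generated (interpHom (stack n)) hbij _ (fun b => cX.ctrlHom b)
    (fun b a => interpPairHom_ctrlHom b a) cX.ctrlHom_commute (topPoint n) (cX.topGate n)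
    (interpPairHom_eq_swap (interpHom_topGate n)) (cX.topGate_mul_self n) hstab ?_ ?_
  · intro q hq
    rcases n with _ | m
    · exact absurd (topPoint_zero_unique q) hq
    · refine ⟨perm2Pair (bit false) (topPoint m), cX.topGate m,
        fun h => Bool.false_ne_true (perm2Pair_bit_injective h).1, ?_,
        fun b => cX.topGate_braid b m⟩
      exact (interpHom_topGate m).trans (swap_comm _ _)
  · exact eq_top_iff.2 fun f _ => (generated_cropX f).recast_mem_closure n rfl rfl

/-- The commutation relation for the next number of wires. The permutations that fix the string of
`1 + n` bits `true` are generated as in `mem_of_fixes_true`, and for each of the three kinds of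
generators the two gates to be compared have a common control wire. -/
theorem commute_topGate_succ (n : ℕ) (hbij : Function.Bijective (interpHom (1 + stack n)))
    (hstab : ∀ b g, interpHom (stack n) g (topPoint n) = topPoint n →
      Commute (cX.ctrlHom b g) (cX.topGate n))
    (hsurj : Function.Surjective (interpHom (stack n)))
    (b : Bool) (g : cX.Hom (1 + stack n) (1 + stack n))
    (hg : interpHom (1 + stack n) g (perm2Pair (bit true) (topPoint n)) =
      perm2Pair (bit true) (topPoint n)) :
    Commute (cX.ctrlHom b g) (cX.ctrlSnd true (cX.topGate n)) := by
  let e : cX.Hom (1 + stack n) (1 + stack n) ≃* Perm (Bool × Fin (2 ^ stack n)) :=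
    MulEquiv.ofBijective (interpPairHom (stack n)) ((bijective_interpPairHom_iff _).2 hbij)
  have he (a) : e.symm (interpPairHom (stack n) a) = a := e.symm_apply_apply a
  let c : Perm (Bool × Fin (2 ^ stack n)) →* (cX.Hom (1 + (1 + stack n)) (1 + (1 + stack n)))ˣ :=
    ((cX.ctrlHom b).comp e.symm.toMonoidHom).toHomUnits
  have hc (a) : (c (interpPairHom (stack n) a) : cX.Hom (1 + (1 + stack n)) _) =
      cX.ctrlHom b a := congrArg (cX.ctrlHom b) (he a)
  let M : Subgroup (Perm (Bool × Fin (2 ^ stack n))) :=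
    { carrier := {σ | Commute (c σ : cX.Hom (1 + (1 + stack n)) _)
        (cX.ctrlSnd true (cX.topGate n))}
      one_mem' := by
        rw [Set.mem_ofPred_eq, map_one]
        exact Commute.one_left _
      mul_mem' := fun {σ τ} hσ hτ => by
        rw [Set.mem_ofPred_eq, map_mul]
        exact Commute.mul_left hσ hτ
      inv_mem' := fun {σ} hσ => by
        rw [Set.mem_ofPred_eq, map_inv]
        exact Commute.units_inv_left hσ }
  have hM (a) : interpPairHom (stack n) a ∈ M ↔
      Commute (cX.ctrlHom b a) (cX.ctrlSnd true (cX.topGate n)) := by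
    rw [← hc a]; rfl
  rw [← hM]
  refine mem_of_fixes_true (topPoint n) M ?_ ?_ ?_ _ ?_
  · intro g
    obtain ⟨a, rfl⟩ := hsurj g
    rw [← interpPairHom_ctrlHom, hM]
    exact cX.commute_topGate_ctrlHom_ctrlHom_false b n a
  · intro g hg
    obtain ⟨a, rfl⟩ := hsurj g
    rw [← interpPairHom_ctrlHom, hM]
    exact cX.commute_topGate_ctrlHom_ctrlHom_true b n a (hstab b a hg)
  · intro r hr
    rcases n with _ | m
    · exact absurd (topPoint_zero_unique r) hr
    · refine ⟨perm2Pair (bit false) (topPoint m),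
        fun h => Bool.false_ne_true (perm2Pair_bit_injective h).1, ?_⟩
      have h := interpPairHom_eq_swap
        (interpHom_ctrlSnd false (cX.topGate m) (topPoint m) (interpHom_topGate m))
      exact h ▸ (hM _).2 (cX.commute_topGate_ctrlHom_ctrlSnd_false b m)
  · rw [interpPairHom_apply, permCongr_apply, symm_symm, bitPair_apply, hg, ← bitPair_apply,
      symm_apply_apply]

/-- The interpretation is bijective on endomorphisms. The induction carries along that a gate whose
interpretation fixes the string of bits `true` commutes, once controlled by a further wire, with
the multiply controlled NOT gate on that wire. -/
theorem bijective_interpHom_and_commute (n : ℕ) : Function.Bijective (interpHom (stack n)) ∧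
    ∀ b g, interpHom (stack n) g (topPoint n) = topPoint n →
      Commute (cX.ctrlHom b g) (cX.topGate n) := by
  induction n with
  | zero =>
    have hone (f : cX.Hom 0 0) : f = 1 := (generated_cropX f).recast_eq_id rfl rfl
    refine ⟨⟨fun f g _ => (hone f).trans (hone g).symm, fun σ => ⟨1, ?_⟩⟩, fun b g _ => ?_⟩
    · exact Subsingleton.elim (α := Perm (Fin 1)) _ _
    · rw [show g = 1 from hone g, map_one]
      exact Commute.one_left _
  | succ n ih =>
    have h := bijective_interpHom_succ n ih.1 ih.2
    exact ⟨h, fun b g hg => commute_topGate_succ n h ih.2 ih.1.2 b g hg⟩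

theorem bijective_interpHom (n : ℕ) : Function.Bijective (interpHom n) := by
  have h := (bijective_interpHom_and_commute n).1
  rwa [stack_eq] at h

theorem bijective_interp (m n : ℕ) :
    Function.Bijective (interp.map : (controlled cropX).Hom m n → perm2.Hom m n) := by
  refine ⟨fun f g h => ?_, fun σ => ?_⟩
  · obtain rfl := (controlled cropX).endo f
    exact (bijective_interpHom m).1 h
  · obtain rfl := perm2.endo σ
    exact (bijective_interpHom m).2 σ

end Interpretation

/-- A crop morphism that is bijective on morphisms is an isomorphism. -/
theorem CropHom.nonempty_iso {P Q : Crop.{0}} (h : CropHom P Q)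
    (hbij : ∀ m n, Function.Bijective (h.map : P.Hom m n → Q.Hom m n)) :
    Nonempty (CropIso P Q) := by
  choose g hg using fun m n => (hbij m n).2
  have hinj {m n : ℕ} {f f' : P.Hom m n} (hf : h.map f = h.map f') : f = f' := (hbij m n).1 hf
  exact ⟨{
    hom := h
    inv := {
      map := fun f => g _ _ f
      map_id := fun n => hinj (by rw [hg, h.map_id])
      map_comp := fun _ _ => hinj (by rw [hg, h.map_comp, hg, hg])
      map_tensor := fun _ _ => hinj (by rw [hg, h.map_tensor, hg, hg])
      map_swap := fun _ _ => hinj (by rw [hg, h.map_swap])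
      map_x := hinj (by rw [hg, h.map_x]) }
    hom_inv := fun _ => hinj (hg _ _ _)
    inv_hom := hg _ _ }⟩

theorem mainTheorem2 : Nonempty (CropIso (controlled cropX) perm2) := by
  exact interp.nonempty_iso bijective_interp
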